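/- Let $H$ be a separable complex Hilbert space, $n\ge 0$, $\tau=(T_1,\dots,T_n)$ an $n$-tuple of bounded operators on $H$, $m\ge 1$, and let $c_1,c_2,a_1,\dots,a_m$ be real numbers with $0\le c_1\le a_j\le c_2$ for $j=1,\dots,m$. For an $m\times m$ matrix $Z$ put $\tau\otimes Z=(T_1\otimes Z,\dots,T_n\otimes Z)$, a tuple of operators on $H\otimes\mathbb{C}^m$. A symmetric norming function $\Phi$ is a norm on the space of finitely supported real sequences with $\Phi((x_j)_j)=\Phi((|x_{\pi(j)}|)_j)$ for all permutations $\pi$ of the index set. For a compact operator $T$ let $\mu_1(T)\ge\mu_2(T)\ge\cdots$ be its singular values (the eigenvalues of $|T|$ in decreasing order with multiplicity, continued by zeros), and put $$|T|_\Phi=\sup_N\Phi(\mu_1(T),\dots,\mu_N(T),0,0,\dots),\qquad |T|_p^-=\sum_{j=1}^\infty\frac{\mu_j(T)}{j^{1-1/p}}\quad(1<p\le\infty,\ 1/\infty=0),$$ both in $[0,\infty]$. For a tuple $\sigma=(S_1,\dots,S_n)$ of bounded operators on a Hilbert space $K$ define $$k_\Phi(\sigma)=\liminf_{A}\ \max_{1\le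 i\le n}|[S_i,A]|_\Phi\in[0,\infty],$$ where $A$ runs through the positive contractions of finite rank on $K$, directed by the usual order of self-adjoint operators; $k_p^-(\sigma)$ is defined in the same way with $|\cdot|_p^-$ in place of $|\cdot|_\Phi$. An empty maximum is $0$, and $0\cdot\infty=0$. Then for every symmetric norming function $\Phi$ $$c_1\,k_\Phi(\tau\otimes I_m)\le k_\Phi(\tau\otimes\operatorname{diag}(a_j)_{j=1}^m)\le c_2\,k_\Phi(\tau\otimes I_m),$$ and for every $1<p\le\infty$ $$c_1\,m^{1/p}\,k_p^-(\tau)\le k_p^-(\tau\otimes\operatorname{diag}(a_j)_{j=1}^m)\le c_2\,m^{1/p}\,k_p^-(\tau).$$ -/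

import Mathlib

open scoped ENNReal TensorProduct

noncomputable section

/-- A symmetric norming function: a norm on the space of finitely supported real sequences which is
invariant under permutations of the entries and under replacing the entries by their absolute
values. The normalization `Φ (1, 0, 0, …) = 1` is not required. -/
structure SymmetricNormingFunction where
  /-- the underlying function on finitely supported real sequences -/
  toFun : (ℕ →₀ ℝ) → ℝ
  pos' : ∀ x, x ≠ 0 → 0 < toFun x
  smul' : ∀ (c : ℝ) x, toFun (c • x) = |c| * toFun x
  add_le' : ∀ x y, toFun (x + y) ≤ toFun x + toFun y
  perm' : ∀ (σ : Equiv.Perm ℕ) x, toFun (x.equivMapDomain σ) = toFun x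
  abs' : ∀ x, toFun (x.mapRange (fun t : ℝ => |t|) abs_zero) = toFun x

section Operators

variable {H : Type*} [NormedAddCommGroup H] [InnerProductSpace ℂ H] [CompleteSpace H]

/-- The singular values `μ₀(T) ≥ μ₁(T) ≥ …` of a compact operator `T`: the eigenvalues of
`|T| = (T* T)^(1/2)` in decreasing order, repeated according to multiplicity, and followed by zeros
if there are only finitely many nonzero ones. The `j`-th one is the largest `t > 0` such that the
eigenvectors of `|T|` with eigenvalue at least `t` span a space of dimension larger than `j`; it is
`0` if there is no such `t`. -/
def singularValue (T : H →L[ℂ] H) (j : ℕ) : ℝ :=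
  sSup {t : ℝ | 0 < t ∧
    (j : Cardinal) < Module.rank ℂ
      (⨆ s ∈ Set.Ici t, Module.End.eigenspace ((CFC.abs T : H →L[ℂ] H) : H →ₗ[ℂ] H) (s : ℂ) :
        Submodule ℂ H)}

open Classical in
/-- The norm `|T|_Φ = sup_N Φ(μ₀(T), …, μ_{N-1}(T), 0, 0, …)` of the operator ideal of `Φ`, with
values in `[0, ∞]`; it is `∞` if `T` is not compact. -/
def SymmetricNormingFunction.opNorm (Φ : SymmetricNormingFunction) (T : H →L[ℂ] H) : ℝ≥0∞ :=
  if IsCompactOperator T then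
    ⨆ N : ℕ, ENNReal.ofReal (Φ.toFun (∑ j ∈ Finset.range N, Finsupp.single j (singularValue T j)))
  else ∞

open Classical in
/-- The norm `|T|_p⁻ = ∑_{j ≥ 1} μ_j(T) / j^(1 - 1/p)` of the `(p, 1)`-Lorentz ideal (here the
singular values are indexed from `0`), with `1 / ∞ = 0`; it is `∞` if `T` is not compact. -/
def lorentzNorm (p : ℝ≥0∞) (T : H →L[ℂ] H) : ℝ≥0∞ :=
  if IsCompactOperator T then
    ∑' j : ℕ, ENNReal.ofReal (singularValue T j / ((j : ℝ) + 1) ^ (1 - p⁻¹.toReal))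
  else ∞

variable (H) in
/-- The positive contractions of finite rank on `H`, a directed set for the usual (Loewner) order of
self-adjoint operators, which this subtype inherits. -/
abbrev FiniteRankPosContraction : Type _ :=
  {A : H →L[ℂ] H // A.IsPositive ∧ ‖A‖ ≤ 1 ∧ FiniteDimensional ℂ A.range}

/-- The quasicentral modulus of the `n`-tuple `τ` for an operator ideal norm `ν`: the limit inferior
of `max_i ν([T_i, A])` over the directed set of all positive contractions `A` of finite rank. -/
def quasicentralModulus (ν : (H →L[ℂ] H) → ℝ≥0∞) {n : ℕ} (τ : Fin n → H →L[ℂ] H) : ℝ≥0∞ :=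
  Filter.liminf (fun A : FiniteRankPosContraction H => ⨆ i, ν (τ i * A.1 - A.1 * τ i)) Filter.atTop

/-- The quasicentral modulus `k_Φ(τ)`. -/
def kPhi (Φ : SymmetricNormingFunction) {n : ℕ} (τ : Fin n → H →L[ℂ] H) : ℝ≥0∞ :=
  quasicentralModulus Φ.opNorm τ

/-- The quasicentral modulus `k_p⁻(τ)`. -/
def kMinus (p : ℝ≥0∞) {n : ℕ} (τ : Fin n → H →L[ℂ] H) : ℝ≥0∞ :=
  quasicentralModulus (lorentzNorm p) τ

end Operators

section Tensor

variable (H : Type*) [NormedAddCommGroup H] [InnerProductSpace ℂ H]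

/-- The identification of `H ⊗ ℂ^m` with the direct sum of `m` copies of `H`; it maps `ξ ⊗ v` to
`(v₁ ξ, …, v_m ξ)`. -/
def tensorEquiv (m : ℕ) :
    H ⊗[ℂ] EuclideanSpace ℂ (Fin m) ≃ₗ[ℂ] PiLp 2 (fun _ : Fin m => H) :=
  TensorProduct.congr (LinearEquiv.refl ℂ H) (WithLp.linearEquiv 2 ℂ (Fin m → ℂ)) ≪≫ₗ
    TensorProduct.piScalarRight ℂ ℂ H (Fin m) ≪≫ₗ
    (WithLp.linearEquiv 2 ℂ (Fin m → H)).symm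

variable {H}

theorem tensorEquiv_tmul {m : ℕ} (ξ : H) (v : EuclideanSpace ℂ (Fin m)) (j : Fin m) :
    tensorEquiv H m (ξ ⊗ₜ[ℂ] v) j = v j • ξ := by
  simp [tensorEquiv]

theorem tensorEquiv_inner {m : ℕ} (x y : H ⊗[ℂ] EuclideanSpace ℂ (Fin m)) :
    inner ℂ (tensorEquiv H m x) (tensorEquiv H m y) = inner ℂ x y := by
  induction x with
  | zero => simp
  | add x₁ x₂ h₁ h₂ => simp [inner_add_left, h₁, h₂]
  | tmul ξ v =>
    induction y with
    | zero => simp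
    | add y₁ y₂ h₁ h₂ => simp [inner_add_right, h₁, h₂]
    | tmul η w =>
      simp only [PiLp.inner_apply, tensorEquiv_tmul, inner_smul_left, inner_smul_right,
        TensorProduct.inner_tmul, RCLike.inner_apply, Finset.mul_sum]
      refine Finset.sum_congr rfl fun j _ => ?_
      ring

variable (H) in
/-- The identification `tensorEquiv` preserves the inner product. -/
def tensorIsometry (m : ℕ) :
    H ⊗[ℂ] EuclideanSpace ℂ (Fin m) ≃ₗᵢ[ℂ] PiLp 2 (fun _ : Fin m => H) :=
  (tensorEquiv H m).isometryOfInner tensorEquiv_inner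

/-- The algebraic tensor product of a Hilbert space with `ℂ^m` is already complete. -/
instance instCompleteSpaceTensor [CompleteSpace H] (m : ℕ) :
    CompleteSpace (H ⊗[ℂ] EuclideanSpace ℂ (Fin m)) :=
  (completeSpace_congr (e := (tensorIsometry H m).toEquiv)
    (tensorIsometry H m).isometry.isUniformEmbedding).2 inferInstance

/-- The tuple `τ ⊗ Z = (T₁ ⊗ Z, …, T_n ⊗ Z)` of operators on `H ⊗ ℂ^m`, for an `m × m` matrix `Z`
acting on `ℂ^m`. -/
def tensorTuple {n m : ℕ} (τ : Fin n → H →L[ℂ] H) (Z : Matrix (Fin m) (Fin m) ℂ) :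
    Fin n → (H ⊗[ℂ] EuclideanSpace ℂ (Fin m)) →L[ℂ] (H ⊗[ℂ] EuclideanSpace ℂ (Fin m)) :=
  fun i => TensorProduct.mapL (τ i) (Matrix.toEuclideanCLM (𝕜 := ℂ) Z)

end Tensor

end

/-! Identify H ⊗ ℂ^m with m copies of H, so that T_i ⊗ diag(a_j) becomes block diagonal with blocks
a_j T_i. Pinching an operator to its diagonal blocks is an average of unitary conjugations, so it
does not increase a symmetric ideal norm; neither does multiplication by a diagonal contraction. A
competitor A may therefore be replaced by its pinching, and the commutators then have blocks a_j
[T_i, A_jj]. Comparing coefficients gives the bounds with c₁ and c₂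
(`quasicentralModulus_blockDiag_le`).

For the second claim it remains to see that k_p⁻(τ ⊗ I) = m^(1/p) k_p⁻(τ). Averaging the blocks
reduces competitors to the form A ⊕ ⋯ ⊕ A. Repeating a finite rank operator X m times multiplies its
Lorentz norm by at least m^(1/p), and by at most this factor up to an additive error m‖X‖. The error
is harmless because the commutators can be made small in operator norm
(`IsSymmetricIdealNorm.exists_norm_commutator_le`): choose competitors successively, each the
identity on a space large enough that its commutators are orthogonal to the earlier ones. Their sum
stays bounded in norm, and dividing by the number of competitors makes it small.

Both norms are symmetric on finite rank operators because partial sums of singular values have a Ky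
Fan variational formula (`IsSchmidt.sum_re_inner_le`), and both respect weak majorization. All
competitors have finite rank, so finite Schmidt decompositions suffice. -/

section

open scoped InnerProductSpace

/-! ### Weak majorization of decreasing sequences -/

/-- Abel summation: pairing with a nonnegative decreasing weight respects weak majorization. -/
theorem sum_mul_le_sum_mul_of_partialSums {w x y : ℕ → ℝ} (hw : Antitone w) (hw0 : ∀ j, 0 ≤ w j)
    (h : ∀ k, ∑ j ∈ Finset.range k, x j ≤ ∑ j ∈ Finset.range k, y j) (N : ℕ) :
    ∑ j ∈ Finset.range N, w j * x j ≤ ∑ j ∈ Finset.range N, w j * y j := by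
  -- Summation by parts as an induction: the partial sums of `y - x` are nonnegative, so lowering
  -- the weight in front of them only loses.
  have key : ∀ N, w N * ∑ j ∈ Finset.range N, (y j - x j) ≤
      ∑ j ∈ Finset.range N, w j * (y j - x j) := by
    intro N
    induction N with
    | zero => simp
    | succ N ih =>
      rw [Finset.sum_range_succ (fun j => w j * (y j - x j))]
      have h1 : 0 ≤ ∑ j ∈ Finset.range (N + 1), (y j - x j) := by
        rw [Finset.sum_sub_distrib]; linarith [h (N + 1)]
      have h2 := mul_le_mul_of_nonneg_right (hw (Nat.le_succ N)) h1
      rw [Finset.sum_range_succ, mul_add] at h2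
      rw [Finset.sum_range_succ]
      simp only [Nat.succ_eq_add_one] at h2
      linarith
  have h1 : 0 ≤ ∑ j ∈ Finset.range N, (y j - x j) := by
    rw [Finset.sum_sub_distrib]; linarith [h N]
  have h2 := (mul_nonneg (hw0 N) h1).trans (key N)
  simp only [mul_sub, Finset.sum_sub_distrib] at h2
  linarith

/-- Weights between `0` and `1` of total mass at most `k` cannot give more than the first `k`
terms of a decreasing sequence. -/
theorem sum_mul_le_sum_range {μ d : ℕ → ℝ} (hμ : Antitone μ) (hμ0 : ∀ j, 0 ≤ μ j) {r k : ℕ}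
    (hd0 : ∀ j, 0 ≤ d j) (hd1 : ∀ j, d j ≤ 1) (hd : ∑ j ∈ Finset.range r, d j ≤ k) :
    ∑ j ∈ Finset.range r, μ j * d j ≤ ∑ j ∈ Finset.range k, μ j := by
  -- After subtracting `μ k` the terms are nonnegative before index `k` and nonpositive after it, so
  -- the best weight is the indicator of `j < k`. The subtracted mass is controlled by `hd`.
  have h1 : ∑ j ∈ Finset.range r, (μ j - μ k) * d j ≤ ∑ j ∈ Finset.range k, (μ j - μ k) := by
    calc ∑ j ∈ Finset.range r, (μ j - μ k) * d j
        ≤ ∑ j ∈ Finset.range r, if j < k then μ j - μ k else 0 := by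
          refine Finset.sum_le_sum fun j _ => ?_
          split_ifs with hj
          · have := hμ hj.le
            nlinarith [hd1 j]
          · have := hμ (not_lt.1 hj)
            nlinarith [hd0 j]
      _ = ∑ j ∈ (Finset.range r).filter (· < k), (μ j - μ k) := by rw [Finset.sum_filter]
      _ ≤ ∑ j ∈ Finset.range k, (μ j - μ k) := by
          refine Finset.sum_le_sum_of_subset_of_nonneg (fun j hj => ?_) fun j hj _ => ?_
          · simp at hj ⊢; exact hj.2
          · simp at hj; linarith [hμ hj.le]
  simp only [sub_mul, Finset.sum_sub_distrib, ← Finset.mul_sum, Finset.sum_const,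
    Finset.card_range, nsmul_eq_mul] at h1
  nlinarith [mul_le_mul_of_nonneg_left hd (hμ0 k)]

/-! ### Symmetric norming functions and weak majorization -/

namespace SymmetricNormingFunction

variable (Φ : SymmetricNormingFunction)

/-- The finitely supported sequence with the given first `N` terms. -/
noncomputable def ofFin (N : ℕ) : (Fin N → ℝ) →ₗ[ℝ] (ℕ →₀ ℝ) :=
  Finsupp.lmapDomain ℝ ℝ (Fin.val : Fin N → ℕ) ∘ₗ
    (Finsupp.linearEquivFunOnFinite ℝ ℝ (Fin N)).symm.toLinearMap

theorem ofFin_val {N : ℕ} (z : Fin N → ℝ) (i : Fin N) : ofFin N z i = z i := by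
  simp [ofFin, Finsupp.mapDomain_apply Fin.val_injective]

theorem ofFin_of_le {N : ℕ} (z : Fin N → ℝ) {i : ℕ} (hi : N ≤ i) : ofFin N z i = 0 := by
  refine Finsupp.mapDomain_of_notMem_range _ _ ?_
  rintro ⟨j, rfl⟩
  exact absurd j.2 (not_lt.2 hi)

theorem ofFin_ext {N : ℕ} {x : ℕ →₀ ℝ} {z : Fin N → ℝ} (h1 : ∀ i : Fin N, x i = z i)
    (h2 : ∀ i, N ≤ i → x i = 0) : x = ofFin N z := by
  ext i
  rcases lt_or_ge i N with hi | hi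
  · have := h1 ⟨i, hi⟩
    rw [← ofFin_val z] at this
    exact this
  · rw [h2 i hi, ofFin_of_le z hi]

theorem sum_single_eq_ofFin (x : ℕ → ℝ) (N : ℕ) :
    ∑ j ∈ Finset.range N, Finsupp.single j (x j) = ofFin N (fun i => x i) := by
  refine ofFin_ext (fun i => ?_) fun i hi => ?_
  · simp [Finsupp.finsetSum_apply, Finsupp.single_apply]
  · simp [Finsupp.finsetSum_apply, Finsupp.single_apply, hi]

theorem toFun_ofFin_perm {N : ℕ} (σ : Equiv.Perm (Fin N)) (z : Fin N → ℝ) :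
    Φ.toFun (ofFin N (z ∘ σ)) = Φ.toFun (ofFin N z) := by
  classical
  -- Extend by the identity beyond `N`; the inverse appears because `equivMapDomain` evaluates at
  -- the inverse permutation.
  let ρ : Equiv.Perm ℕ := Equiv.Perm.extendDomain σ.symm (Fin.equivSubtype (n := N))
  have hρ : ∀ i : Fin N, ρ.symm i = σ i := by
    intro i
    rw [Equiv.symm_apply_eq]
    have := Equiv.Perm.extendDomain_apply_image σ.symm (Fin.equivSubtype (n := N)) (σ i)
    simpa [ρ, Fin.equivSubtype] using this.symm
  have hρ' : ∀ i, N ≤ i → ρ.symm i = i := by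
    intro i hi
    rw [Equiv.symm_apply_eq]
    exact (Equiv.Perm.extendDomain_apply_not_subtype σ.symm (Fin.equivSubtype (n := N))
      (not_lt.2 hi)).symm
  rw [← Φ.perm' ρ (ofFin N z)]
  congr 1
  symm
  refine ofFin_ext (fun i => ?_) fun i hi => ?_
  · rw [Finsupp.equivMapDomain_apply, hρ, ofFin_val]; rfl
  · rw [Finsupp.equivMapDomain_apply, hρ' i hi, ofFin_of_le z hi]

theorem toFun_ofFin_abs {N : ℕ} (z : Fin N → ℝ) :
    Φ.toFun (ofFin N (fun i => |z i|)) = Φ.toFun (ofFin N z) := by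
  rw [← Φ.abs' (ofFin N z)]
  congr 1
  symm
  refine ofFin_ext (fun i => ?_) fun i hi => ?_
  · rw [Finsupp.mapRange_apply, ofFin_val]
  · rw [Finsupp.mapRange_apply, ofFin_of_le z hi, abs_zero]

/-- A symmetric norming function respects weak majorization. -/
theorem toFun_ofFin_le {N : ℕ} {x y : ℕ → ℝ} (hx : Antitone x) (hx0 : ∀ j, 0 ≤ x j)
    (hy0 : ∀ j, 0 ≤ y j)
    (h : ∀ k, ∑ j ∈ Finset.range k, x j ≤ ∑ j ∈ Finset.range k, y j) :
    Φ.toFun (ofFin N (fun i => x i)) ≤ Φ.toFun (ofFin N (fun i => y i)) := by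
  classical
  -- The signed permutations of `y` all have the same `Φ`-value, and sublevel sets of `Φ` are
  -- convex. It suffices that `x` lies in their convex hull.
  let S : Set (Fin N → ℝ) := Set.range fun p : Equiv.Perm (Fin N) × (Fin N → Bool) =>
    fun i => (if p.2 i then 1 else -1) * y (p.1 i)
  have hS : S.Finite := Set.finite_range _
  let C : Set (Fin N → ℝ) := {z | Φ.toFun (ofFin N z) ≤ Φ.toFun (ofFin N (fun i => y i))}
  have hC : Convex ℝ C := by
    intro u hu v hv a b ha hb hab
    have h1 := Φ.add_le' (a • ofFin N u) (b • ofFin N v)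
    rw [Φ.smul', Φ.smul', abs_of_nonneg ha, abs_of_nonneg hb] at h1
    change Φ.toFun (ofFin N (a • u + b • v)) ≤ _
    rw [map_add, map_smul, map_smul]
    have hu' : Φ.toFun (ofFin N u) ≤ Φ.toFun (ofFin N (fun i => y i)) := hu
    have hv' : Φ.toFun (ofFin N v) ≤ Φ.toFun (ofFin N (fun i => y i)) := hv
    calc _ ≤ _ := h1
      _ ≤ a * Φ.toFun (ofFin N (fun i => y i)) + b * Φ.toFun (ofFin N (fun i => y i)) := by gcongr
      _ = _ := by rw [← add_mul, hab, one_mul]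
  have hSC : S ⊆ C := by
    rintro _ ⟨⟨σ, ε⟩, rfl⟩
    change Φ.toFun _ ≤ _
    rw [← Φ.toFun_ofFin_abs, ← Φ.toFun_ofFin_perm σ (fun i => y i)]
    refine le_of_eq ?_
    congr 2
    ext i
    rw [abs_mul, abs_of_nonneg (hy0 _)]
    simp only [Function.comp]
    split_ifs <;> simp
  suffices hmem : (fun i : Fin N => x i) ∈ convexHull ℝ S from convexHull_min hSC hC hmem
  -- A separating functional would take a larger value at `x` than on all of `S`. By rearrangement
  -- its value at `x` is at most the pairing with its decreasingly sorted absolute coefficients, to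
  -- which Abel summation applies.
  by_contra hmem
  obtain ⟨f, u, hfS, hfx⟩ := geometric_hahn_banach_closed_point (convex_convexHull ℝ S)
    (hS.isClosed_convexHull (𝕜 := ℝ)) hmem
  let c : Fin N → ℝ := fun i => f (Pi.single i 1)
  have hf : ∀ z, f z = ∑ i, c i * z i := by
    intro z
    conv_lhs => rw [← Finset.univ_sum_single z]
    rw [map_sum]
    refine Finset.sum_congr rfl fun i _ => ?_
    have : (Pi.single i (z i) : Fin N → ℝ) = z i • Pi.single i 1 := by
      rw [← Pi.single_smul]; simp
    rw [this, map_smul, smul_eq_mul, mul_comm]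
  let σ : Equiv.Perm (Fin N) := Tuple.sort (fun i => -|c i|)
  have hσ : Antitone fun i => |c (σ i)| := by
    intro i j hij
    have := Tuple.monotone_sort (fun i => -|c i|) hij
    simp only [Function.comp] at this
    exact neg_le_neg_iff.1 this
  let w : ℕ → ℝ := fun j => if hj : j < N then |c (σ ⟨j, hj⟩)| else 0
  have hw0 : ∀ j, 0 ≤ w j := by
    intro j; simp only [w]; split_ifs <;> simp
  have hw : Antitone w := by
    intro i j hij
    by_cases hj : j < N
    · have hi : i < N := lt_of_le_of_lt hij hj
      simp only [w, hi, hj, dif_pos]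
      exact hσ hij
    · simp only [w, hj, dif_neg, not_false_iff]
      exact hw0 i
  have h1 : f (fun i => x i) ≤ ∑ j ∈ Finset.range N, w j * x j := by
    rw [hf, Finset.sum_range]
    calc ∑ i : Fin N, c i * x i ≤ ∑ i : Fin N, |c i| * x i :=
          Finset.sum_le_sum fun i _ => mul_le_mul_of_nonneg_right (le_abs_self _) (hx0 _)
      _ = ∑ i : Fin N, |c (σ i)| * x (σ i) := (Equiv.sum_comp σ fun i => |c i| * x i).symm
      _ ≤ ∑ i : Fin N, |c (σ i)| * x i := by
          have hmv : Monovary (fun i : Fin N => |c (σ i)|) (fun i : Fin N => x i) := by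
            intro i j hij
            refine hσ (le_of_not_gt fun hlt => ?_)
            exact absurd (hx (Fin.val_fin_le.2 hlt.le)) (not_le.2 hij)
          exact hmv.sum_mul_comp_perm_le_sum_mul (σ := σ)
      _ = _ := by
          refine Finset.sum_congr rfl fun i _ => ?_
          simp [w]
  have h2 : ∑ j ∈ Finset.range N, w j * y j < u := by
    -- The point of `S` that aligns the order and the signs of `y` with the coefficients of `f`
    -- realizes the sorted pairing.
    have hs := hfS _ (subset_convexHull ℝ S
      (Set.mem_range_self (σ.symm, fun i => decide (0 ≤ c i))))
    rw [hf] at hs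
    refine lt_of_eq_of_lt ?_ hs
    rw [Finset.sum_range]
    refine Eq.trans ?_ (Equiv.sum_comp σ _)
    refine Finset.sum_congr rfl fun i _ => ?_
    simp only [w, Fin.is_lt, dif_pos, Fin.eta, Equiv.symm_apply_apply, decide_eq_true_eq]
    split_ifs with hc
    · rw [abs_of_nonneg hc]; ring
    · rw [abs_of_neg (not_le.1 hc)]; ring
  exact absurd (hfx.trans_le (h1.trans (sum_mul_le_sum_mul_of_partialSums hw hw0 h N)))
    (not_lt.2 h2.le)

end SymmetricNormingFunction

/-! ### Schmidt decompositions and singular values -/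

section Schmidt

variable {H : Type*} [NormedAddCommGroup H] [InnerProductSpace ℂ H] [CompleteSpace H]

/-- A Schmidt decomposition `T = ∑_{j < r} s_j ⟨e_j, ·⟩ f_j` of a finite rank operator. -/
structure IsSchmidt (T : H →L[ℂ] H) {r : ℕ} (s : Fin r → ℝ) (e f : Fin r → H) : Prop where
  pos : ∀ j, 0 < s j
  anti : Antitone s
  orthonormal_left : Orthonormal ℂ e
  orthonormal_right : Orthonormal ℂ f
  apply_eq : ∀ x, T x = ∑ j, (s j : ℂ) • ⟪e j, x⟫_ℂ • f j

/-- An operator and its absolute value have the same norm at each vector. -/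
theorem norm_cfcAbs_apply (T : H →L[ℂ] H) (x : H) : ‖CFC.abs T x‖ = ‖T x‖ := by
  have hsa : IsSelfAdjoint (CFC.abs T) := (CFC.abs_nonneg T).isSelfAdjoint
  have h1 : ⟪CFC.abs T x, CFC.abs T x⟫_ℂ = ⟪T x, T x⟫_ℂ := by
    have h := congrArg (fun A : H →L[ℂ] H => ⟪x, A x⟫_ℂ) (CFC.abs_mul_abs T)
    simp only [mul_apply_eq_comp, ContinuousLinearMap.star_eq_adjoint,
      ContinuousLinearMap.adjoint_inner_right] at h
    rw [← h, ← ContinuousLinearMap.adjoint_inner_right, hsa.adjoint_eq]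
  rw [inner_self_eq_norm_sq_to_K, inner_self_eq_norm_sq_to_K] at h1
  have h2 : ‖CFC.abs T x‖ ^ 2 = ‖T x‖ ^ 2 := by exact_mod_cast h1
  exact (sq_eq_sq₀ (norm_nonneg _) (norm_nonneg _)).1 h2

/-- `T` and its absolute value have the same kernel, so both ranges are isomorphic to the same
quotient of `H`. -/
theorem finiteDimensional_range_cfcAbs (T : H →L[ℂ] H) [FiniteDimensional ℂ T.range] :
    FiniteDimensional ℂ (CFC.abs T : H →L[ℂ] H).range := by
  have hker : (CFC.abs T : H →L[ℂ] H).ker = T.ker := by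
    ext x
    simp only [LinearMap.mem_ker, ContinuousLinearMap.coe_coe]
    rw [← norm_eq_zero, norm_cfcAbs_apply, norm_eq_zero]
  have e1 := (T : H →ₗ[ℂ] H).quotKerEquivRange
  have e2 := (CFC.abs T : H →L[ℂ] H).toLinearMap.quotKerEquivRange
  have h1 : FiniteDimensional ℂ (H ⧸ T.ker) := Module.Finite.equiv e1.symm
  rw [← hker] at h1
  exact Module.Finite.equiv e2

/-- Diagonalize the absolute value on its finite-dimensional range; the right vectors are the
normalized images under `T` of the eigenvectors. -/
theorem exists_isSchmidt (T : H →L[ℂ] H) [FiniteDimensional ℂ T.range] :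
    ∃ (r : ℕ) (s : Fin r → ℝ) (e f : Fin r → H), IsSchmidt T s e f := by
  classical
  set R : H →L[ℂ] H := CFC.abs T with hR
  have hpos : R.IsPositive := (ContinuousLinearMap.nonneg_iff_isPositive _).1 (CFC.abs_nonneg T)
  have hsym : ∀ x y, ⟪R x, y⟫_ℂ = ⟪x, R y⟫_ℂ := fun x y => hpos.inner_left_eq_inner_right x y
  have hfin : FiniteDimensional ℂ R.range := finiteDimensional_range_cfcAbs T
  let F : Submodule ℂ H := R.range
  have hFinv : ∀ v ∈ F, (R : H →ₗ[ℂ] H) v ∈ F := fun v _ => ⟨v, rfl⟩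
  have hS : ((R : H →ₗ[ℂ] H).restrict hFinv).IsSymmetric :=
    LinearMap.IsSymmetric.restrict_invariant hpos.isSymmetric hFinv
  let r := Module.finrank ℂ F
  let b := hS.eigenvectorBasis (rfl : Module.finrank ℂ F = r)
  let s : Fin r → ℝ := hS.eigenvalues (rfl : Module.finrank ℂ F = r)
  have hb : ∀ j, R (b j : H) = (s j : ℂ) • (b j : H) := by
    intro j
    have := congrArg (Subtype.val) (hS.apply_eigenvectorBasis (rfl : Module.finrank ℂ F = r) j)
    exact this
  have hbo : Orthonormal ℂ (fun j => (b j : H)) :=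
    b.orthonormal.comp_linearIsometry F.subtypeₗᵢ
  have hbn : ∀ j, ⟪(b j : H), (b j : H)⟫_ℂ = 1 := fun j => by
    rw [inner_self_eq_norm_sq_to_K, hbo.1 j]; simp
  have hs0 : ∀ j, 0 ≤ s j := by
    intro j
    have h := hpos.re_inner_nonneg_right (b j : H)
    rw [hb, inner_smul_right, hbn] at h
    simpa using h
  -- A null eigenvector would lie in both the range and the kernel of the self-adjoint `R`, which
  -- are orthogonal.
  have hsne : ∀ j, s j ≠ 0 := by
    intro j hj
    obtain ⟨y, hy⟩ := (b j).2
    have hy' : R y = (b j : H) := hy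
    have h1 : ⟪(b j : H), (b j : H)⟫_ℂ = 0 := by
      rw [← hy', hsym, hy', hb, hj]; simp
    rw [hbn] at h1
    exact one_ne_zero h1
  have hTT : ∀ x y, ⟪T x, T y⟫_ℂ = ⟪R x, R y⟫_ℂ := by
    intro x y
    have h := congrArg (fun A : H →L[ℂ] H => ⟪x, A y⟫_ℂ) (CFC.abs_mul_abs T)
    simp only [mul_apply_eq_comp, ContinuousLinearMap.star_eq_adjoint,
      ContinuousLinearMap.adjoint_inner_right] at h
    rw [← h, hsym]
  refine ⟨r, s, fun j => b j, fun j => (s j : ℂ)⁻¹ • T (b j), ?_, ?_, hbo, ?_, ?_⟩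
  · exact fun j => lt_of_le_of_ne (hs0 j) (hsne j).symm
  · exact hS.eigenvalues_antitone _
  · rw [orthonormal_iff_ite]
    intro i j
    have hi : (s i : ℂ) ≠ 0 := by exact_mod_cast hsne i
    have hj : (s j : ℂ) ≠ 0 := by exact_mod_cast hsne j
    rw [inner_smul_left, inner_smul_right, hTT, hb, hb, inner_smul_left, inner_smul_right,
      orthonormal_iff_ite.1 hbo i j]
    simp only [map_inv₀, Complex.conj_ofReal]
    split_ifs
    · field_simp
    · simp
  · intro x
    -- The part of `x` orthogonal to the range of `R` is killed by `R`, hence by `T`, since the two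
    -- have equal norms at each vector.
    have hker : R (x - ∑ j, ⟪(b j : H), x⟫_ℂ • (b j : H)) = 0 := by
      have hmem : R x ∈ F := ⟨x, rfl⟩
      have h1 := congrArg Subtype.val (b.sum_repr' ⟨R x, hmem⟩)
      simp only [Submodule.coe_sum, Submodule.coe_smul, Submodule.coe_inner] at h1
      rw [map_sub, map_sum, ← h1, sub_eq_zero]
      refine Finset.sum_congr rfl fun j _ => ?_
      rw [map_smul, ← hsym, hb, inner_smul_left, smul_smul, Complex.conj_ofReal, mul_comm]
    rw [← norm_eq_zero, norm_cfcAbs_apply, norm_eq_zero, map_sub, sub_eq_zero, map_sum] at hker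
    rw [hker]
    refine Finset.sum_congr rfl fun j _ => ?_
    have hj : (s j : ℂ) ≠ 0 := by exact_mod_cast hsne j
    rw [map_smul, smul_comm (⟪(b j : H), x⟫_ℂ), smul_inv_smul₀ hj]

namespace IsSchmidt

variable {T : H →L[ℂ] H} {r : ℕ} {s : Fin r → ℝ} {e f : Fin r → H}

/-- The right-hand side defines a positive operator with square `star T * T`; positive square roots
are unique. -/
theorem cfcAbs_apply (h : IsSchmidt T s e f) (x : H) :
    CFC.abs T x = ∑ j, (s j : ℂ) • ⟪e j, x⟫_ℂ • e j := by
  let R : H →L[ℂ] H := ∑ j, (s j : ℂ) • InnerProductSpace.rankOne ℂ (e j) (e j)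
  have hR : ∀ x, R x = ∑ j, (s j : ℂ) • ⟪e j, x⟫_ℂ • e j := by
    intro x; simp [R]
  have hRpos : 0 ≤ R := by
    rw [ContinuousLinearMap.nonneg_iff_isPositive]
    refine ContinuousLinearMap.isPositive_sum _ fun j _ => ?_
    refine (InnerProductSpace.isPositive_rankOne_self (e j)).smul_of_nonneg ?_
    exact_mod_cast (h.pos j).le
  have hRR : R * R = star T * T := by
    ext x
    refine ext_inner_left ℂ fun y => ?_
    have hsa : IsSelfAdjoint R := hRpos.isSelfAdjoint
    rw [mul_apply_eq_comp, mul_apply_eq_comp,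
      ContinuousLinearMap.star_eq_adjoint, ContinuousLinearMap.adjoint_inner_right,
      ← ContinuousLinearMap.adjoint_inner_left, hsa.adjoint_eq, hR, hR, h.apply_eq, h.apply_eq]
    simp only [smul_smul]
    rw [h.orthonormal_left.inner_sum, h.orthonormal_right.inner_sum]
  have : CFC.abs T = R := CFC.sqrt_unique hRR hRpos
  rw [this, hR]

/-- An eigenvector for `u > 0` has coefficients only along those `e j` with `s j = u`. Positivity of
`t` keeps the kernel out. -/
theorem iSup_eigenspace (h : IsSchmidt T s e f) {t : ℝ} (ht : 0 < t) :
    (⨆ u ∈ Set.Ici t, Module.End.eigenspace ((CFC.abs T : H →L[ℂ] H) : H →ₗ[ℂ] H) (u : ℂ) :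
        Submodule ℂ H) = Submodule.span ℂ (Set.range fun j : {j // t ≤ s j} => e j) := by
  classical
  refine le_antisymm (iSup₂_le fun u hu x hx => ?_) (Submodule.span_le.2 ?_)
  · rw [Module.End.mem_eigenspace_iff] at hx
    have hx' : CFC.abs T x = (u : ℂ) • x := hx
    have hu' : t ≤ u := hu
    have hu0 : (u : ℂ) ≠ 0 := by exact_mod_cast (ht.trans_le hu').ne'
    have hcoef : ∀ i, ((s i : ℂ) - u) * ⟪e i, x⟫_ℂ = 0 := by
      intro i
      have h1 := congrArg (fun z => ⟪e i, z⟫_ℂ) hx'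
      simp only [h.cfcAbs_apply, smul_smul] at h1
      rw [h.orthonormal_left.inner_right_fintype, inner_smul_right] at h1
      rw [sub_mul, h1, sub_self]
    have hxe : x = (u : ℂ)⁻¹ • ∑ j, (s j : ℂ) • ⟪e j, x⟫_ℂ • e j := by
      rw [← h.cfcAbs_apply, hx', inv_smul_smul₀ hu0]
    rw [hxe]
    refine Submodule.smul_mem _ _ (Submodule.sum_mem _ fun j _ => ?_)
    rcases mul_eq_zero.1 (hcoef j) with hj | hj
    · have : s j = u := by exact_mod_cast sub_eq_zero.1 hj
      refine Submodule.smul_mem _ _ (Submodule.smul_mem _ _ (Submodule.subset_span ?_))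
      exact ⟨⟨j, this ▸ hu'⟩, rfl⟩
    · simp [hj]
  · rintro _ ⟨⟨j, hj⟩, rfl⟩
    refine Submodule.mem_iSup_of_mem (s j) (Submodule.mem_iSup_of_mem hj ?_)
    rw [Module.End.mem_eigenspace_iff]
    change CFC.abs T (e j) = _
    rw [h.cfcAbs_apply, Finset.sum_eq_single j]
    · rw [orthonormal_iff_ite.1 h.orthonormal_left]; simp
    · intro i _ hij
      rw [orthonormal_iff_ite.1 h.orthonormal_left]; simp [hij]
    · simp

theorem lt_rank_iff (h : IsSchmidt T s e f) {t : ℝ} (ht : 0 < t) (j : ℕ) :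
    (j : Cardinal) < Module.rank ℂ
      (⨆ u ∈ Set.Ici t, Module.End.eigenspace ((CFC.abs T : H →L[ℂ] H) : H →ₗ[ℂ] H) (u : ℂ) :
        Submodule ℂ H) ↔ ∃ hj : j < r, t ≤ s ⟨j, hj⟩ := by
  classical
  have hli : LinearIndependent ℂ (fun j : {j // t ≤ s j} => e j) :=
    h.orthonormal_left.linearIndependent.comp _ Subtype.val_injective
  have hfin : FiniteDimensional ℂ
      (Submodule.span ℂ (Set.range fun j : {j // t ≤ s j} => e j)) :=
    FiniteDimensional.span_of_finite ℂ (Set.finite_range _)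
  rw [h.iSup_eigenspace ht, ← Module.finrank_eq_rank, finrank_span_eq_card hli,
    Nat.cast_lt, Fintype.card_subtype]
  constructor
  · intro hlt
    by_contra! hcon
    have hsub : (Finset.univ.filter fun i => t ≤ s i).card ≤ (Finset.range j).card := by
      refine Finset.card_le_card_of_injOn (fun i => (i : ℕ)) (fun i hi => ?_)
        (fun _ _ _ _ => Fin.ext)
      simp only [Finset.coe_filter, Finset.mem_univ, true_and, Set.mem_ofPred_eq] at hi
      simp only [Finset.coe_range, Set.mem_Iio]
      by_contra hij
      rw [not_lt] at hij
      have hjr := lt_of_le_of_lt hij i.2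
      exact absurd (hi.trans (h.anti (Fin.mk_le_of_le_val hij))) (not_le.2 (hcon hjr))
    rw [Finset.card_range] at hsub
    omega
  · rintro ⟨hj, hts⟩
    have hsub : (Finset.range (j + 1)).card ≤ (Finset.univ.filter fun i => t ≤ s i).card := by
      refine Finset.card_le_card_of_injOn
        -- The default value is never taken on the domain, since `i < j + 1 ≤ r` there.
        (fun i => if hi : i < r then ⟨i, hi⟩ else ⟨j, hj⟩) (fun i hi => ?_) ?_
      · simp only [Finset.coe_range, Set.mem_Iio] at hi
        have hir : i < r := by omega
        simp only [hir, dif_pos, Finset.coe_filter, Finset.mem_univ, true_and, Set.mem_ofPred_eq]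
        exact hts.trans (h.anti (Fin.mk_le_mk.2 (by omega)))
      · intro i hi i' hi' heq
        simp only [Finset.coe_range, Set.mem_Iio] at hi hi'
        have hir : i < r := by omega
        have hir' : i' < r := by omega
        simpa [hir, hir'] using heq
    rw [Finset.card_range] at hsub
    omega

theorem singularValue_eq (h : IsSchmidt T s e f) (j : ℕ) :
    singularValue T j = if hj : j < r then s ⟨j, hj⟩ else 0 := by
  have hset : {t : ℝ | 0 < t ∧ (j : Cardinal) < Module.rank ℂ
      (⨆ u ∈ Set.Ici t, Module.End.eigenspace ((CFC.abs T : H →L[ℂ] H) : H →ₗ[ℂ] H) (u : ℂ) :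
        Submodule ℂ H)} = {t : ℝ | 0 < t ∧ ∃ hj : j < r, t ≤ s ⟨j, hj⟩} := by
    ext t
    exact and_congr_right fun ht => h.lt_rank_iff ht j
  unfold singularValue
  rw [hset]
  split_ifs with hj
  · have : {t : ℝ | 0 < t ∧ ∃ hj : j < r, t ≤ s ⟨j, hj⟩} = Set.Ioc 0 (s ⟨j, hj⟩) := by
      ext t; simp [hj]
    rw [this, csSup_Ioc (h.pos _)]
  -- No `t` qualifies, and the supremum of the empty set of reals is `0`.
  · simp [hj]

theorem singularValue_nonneg (h : IsSchmidt T s e f) (j : ℕ) : 0 ≤ singularValue T j := by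
  rw [h.singularValue_eq]
  split_ifs
  exacts [(h.pos _).le, le_rfl]

theorem singularValue_antitone (h : IsSchmidt T s e f) : Antitone (singularValue T) := by
  intro i j hij
  by_cases hj : j < r
  · rw [h.singularValue_eq, h.singularValue_eq, dif_pos hj, dif_pos (hij.trans_lt hj)]
    exact h.anti hij
  · rw [h.singularValue_eq j, dif_neg hj]
    exact h.singularValue_nonneg i

end IsSchmidt

end Schmidt

/-! ### Finite rank operators -/

section FiniteRank

variable {E F G : Type*} [NormedAddCommGroup E] [InnerProductSpace ℂ E]
  [NormedAddCommGroup F] [InnerProductSpace ℂ F] [NormedAddCommGroup G] [InnerProductSpace ℂ G]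

/-- The operator has finite-dimensional range. -/
def IsFiniteRank (T : E →L[ℂ] F) : Prop := FiniteDimensional ℂ T.range

namespace IsFiniteRank

theorem of_range_le {T : E →L[ℂ] F} (V : Submodule ℂ F) [FiniteDimensional ℂ V]
    (h : ∀ x, T x ∈ V) : IsFiniteRank T :=
  Submodule.finiteDimensional_of_le (show T.range ≤ V by rintro _ ⟨x, rfl⟩; exact h x)

theorem zero : IsFiniteRank (0 : E →L[ℂ] F) :=
  of_range_le ⊥ fun x => by simp

theorem add {S T : E →L[ℂ] F} (hS : IsFiniteRank S) (hT : IsFiniteRank T) :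
    IsFiniteRank (S + T) := by
  have := hS; have := hT
  unfold IsFiniteRank at *
  exact of_range_le (S.range ⊔ T.range) fun x =>
    Submodule.add_mem_sup ⟨x, rfl⟩ ⟨x, rfl⟩

theorem smul {T : E →L[ℂ] F} (c : ℂ) (hT : IsFiniteRank T) : IsFiniteRank (c • T) := by
  unfold IsFiniteRank at hT
  exact of_range_le T.range fun x => Submodule.smul_mem _ _ ⟨x, rfl⟩

theorem sub {S T : E →L[ℂ] F} (hS : IsFiniteRank S) (hT : IsFiniteRank T) :
    IsFiniteRank (S - T) := by
  have := hS.add (hT.smul (-1))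
  rwa [neg_one_smul, ← sub_eq_add_neg] at this

theorem sum {ι : Type*} {T : ι → E →L[ℂ] F} (s : Finset ι) (h : ∀ i ∈ s, IsFiniteRank (T i)) :
    IsFiniteRank (∑ i ∈ s, T i) :=
  Finset.sum_induction _ _ (fun _ _ => add) zero h

theorem comp_right {T : F →L[ℂ] G} (hT : IsFiniteRank T) (S : E →L[ℂ] F) :
    IsFiniteRank (T ∘L S) := by
  unfold IsFiniteRank at hT
  exact of_range_le T.range fun x => ⟨S x, rfl⟩

theorem comp_left {T : E →L[ℂ] F} (hT : IsFiniteRank T) (S : F →L[ℂ] G) :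
    IsFiniteRank (S ∘L T) := by
  unfold IsFiniteRank at hT
  exact of_range_le (T.range.map (S : F →ₗ[ℂ] G)) fun x => ⟨T x, ⟨x, rfl⟩, rfl⟩

theorem mul_right {T : E →L[ℂ] E} (hT : IsFiniteRank T) (S : E →L[ℂ] E) : IsFiniteRank (T * S) :=
  hT.comp_right S

theorem mul_left {T : E →L[ℂ] E} (hT : IsFiniteRank T) (S : E →L[ℂ] E) : IsFiniteRank (S * T) :=
  hT.comp_left S

theorem commutator {A : E →L[ℂ] E} (hA : IsFiniteRank A) (T : E →L[ℂ] E) :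
    IsFiniteRank (T * A - A * T) :=
  (hA.mul_left T).sub (hA.mul_right T)

theorem isCompactOperator {T : E →L[ℂ] F} (hT : IsFiniteRank T) : IsCompactOperator T := by
  unfold IsFiniteRank at hT
  let T' : E →L[ℂ] T.range := T.codRestrict T.range fun x => ⟨x, rfl⟩
  have := FiniteDimensional.proper ℂ T.range
  have h : IsCompactOperator T' :=
    ⟨Metric.closedBall 0 1, isCompact_closedBall _ _,
      T'.continuous.continuousAt.preimage_mem_nhds (by
        rw [map_zero]; exact Metric.closedBall_mem_nhds _ one_pos)⟩
  exact h.clm_comp T.range.subtypeL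

end IsFiniteRank

end FiniteRank

section KyFan

variable {H : Type*} [NormedAddCommGroup H] [InnerProductSpace ℂ H]

/-! ### Symmetric norms on the finite rank operators -/

/-- The properties of the norm of a symmetrically normed ideal, on the finite rank operators. -/
structure IsSymmetricIdealNorm (ν : (H →L[ℂ] H) → ℝ≥0∞) : Prop where
  add_le : ∀ {S T}, IsFiniteRank S → IsFiniteRank T → ν (S + T) ≤ ν S + ν T
  smul_le : ∀ {T} {c : ℝ}, IsFiniteRank T → 0 ≤ c → ν ((c : ℂ) • T) ≤ ENNReal.ofReal c * ν T
  mul_le : ∀ {U T V}, IsFiniteRank T → ‖U‖ ≤ 1 → ‖V‖ ≤ 1 → ν (U * T * V) ≤ ν T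

namespace IsSymmetricIdealNorm

variable {ν : (H →L[ℂ] H) → ℝ≥0∞}

theorem map_zero_le (hν : IsSymmetricIdealNorm ν) : ν 0 ≤ 0 := by
  have := hν.smul_le (T := 0) (c := 0) .zero le_rfl
  simpa using this

theorem sum_le (hν : IsSymmetricIdealNorm ν) {ι : Type*} (s : Finset ι) {T : ι → H →L[ℂ] H}
    (hT : ∀ i ∈ s, IsFiniteRank (T i)) : ν (∑ i ∈ s, T i) ≤ ∑ i ∈ s, ν (T i) := by
  classical
  induction s using Finset.induction_on with
  | empty => simpa using hν.map_zero_le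
  | insert i s hi ih =>
    rw [Finset.sum_insert hi, Finset.sum_insert hi]
    have h1 := fun j hj => hT j (Finset.mem_insert_of_mem hj)
    exact (hν.add_le (hT i (Finset.mem_insert_self i s)) (.sum s h1)).trans (by gcongr; exact ih h1)

/-- Apply `smul_le` with the factor `c⁻¹` to `c • T`; together the two inequalities give positive
homogeneity. -/
theorem mul_le_smul (hν : IsSymmetricIdealNorm ν)
    {T : H →L[ℂ] H} (hT : IsFiniteRank T) {c : ℝ} (hc : 0 ≤ c) :
    ENNReal.ofReal c * ν T ≤ ν ((c : ℂ) • T) := by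
  rcases hc.eq_or_lt with rfl | hc0
  · simp
  have hcC : (c : ℂ) ≠ 0 := by exact_mod_cast hc0.ne'
  have h := hν.smul_le (c := c⁻¹) (hT.smul (c : ℂ)) (inv_nonneg.2 hc)
  rw [Complex.ofReal_inv, inv_smul_smul₀ hcC, ENNReal.ofReal_inv_of_pos hc0] at h
  calc _ ≤ ENNReal.ofReal c * ((ENNReal.ofReal c)⁻¹ * ν ((c : ℂ) • T)) := by gcongr
    _ = _ := by
      rw [← mul_assoc, ENNReal.mul_inv_cancel, one_mul]
      · simpa using hc0
      · exact ENNReal.ofReal_ne_top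

/-- A symmetric norm of an average is at most the bound for the single terms. -/
theorem average_le (hν : IsSymmetricIdealNorm ν) {m : ℕ} (hm : 1 ≤ m) {T : Fin m → H →L[ℂ] H}
    (hT : ∀ i, IsFiniteRank (T i)) {C : ℝ≥0∞} (hC : ∀ i, ν (T i) ≤ C) :
    ν (((m : ℝ)⁻¹ : ℝ) • ∑ i, T i : H →L[ℂ] H) ≤ C := by
  have hm0 : (0 : ℝ) < m := by exact_mod_cast hm
  have h := hν.smul_le (c := (m : ℝ)⁻¹) (IsFiniteRank.sum Finset.univ fun i _ => hT i)
    (by positivity)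
  rw [Complex.coe_smul] at h
  refine h.trans ?_
  calc _ ≤ ENNReal.ofReal (m : ℝ)⁻¹ * ∑ _i : Fin m, C := by
        gcongr
        exact (hν.sum_le _ fun i _ => hT i).trans (Finset.sum_le_sum fun i _ => hC i)
    _ = C := by
        rw [Finset.sum_const, Finset.card_univ, Fintype.card_fin, nsmul_eq_mul, ← mul_assoc,
          ENNReal.ofReal_inv_of_pos hm0, ENNReal.ofReal_natCast, ENNReal.inv_mul_cancel, one_mul]
        · exact_mod_cast (by omega : m ≠ 0)
        · exact ENNReal.natCast_ne_top m

end IsSymmetricIdealNorm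

/-! ### The variational description of the sums of singular values -/

/-- A family satisfying Bessel's inequality. -/
def IsBesselFamily {ι : Type*} [Fintype ι] (u : ι → H) : Prop :=
  ∀ x, ∑ i, ‖⟪u i, x⟫_ℂ‖ ^ 2 ≤ ‖x‖ ^ 2

theorem Orthonormal.isBesselFamily {ι : Type*} [Fintype ι] {u : ι → H} (hu : Orthonormal ℂ u) :
    IsBesselFamily u := fun x => hu.sum_inner_products_le x

namespace IsBesselFamily

variable {ι : Type*} [Fintype ι] {u : ι → H}

/-- Bessel's inequality tested at `u i` itself gives ‖u i‖⁴ ≤ ‖u i‖². -/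
theorem norm_le_one (hu : IsBesselFamily u) (i : ι) : ‖u i‖ ≤ 1 := by
  have h1 := (Finset.single_le_sum (f := fun j => ‖⟪u j, u i⟫_ℂ‖ ^ 2)
    (fun j _ => sq_nonneg _) (Finset.mem_univ i)).trans (hu (u i))
  simp only [inner_self_eq_norm_sq_to_K] at h1
  have h2 : (‖u i‖ ^ 2) ^ 2 ≤ ‖u i‖ ^ 2 := by
    simpa using h1
  by_contra! hlt
  nlinarith [sq_nonneg (‖u i‖ - 1), mul_pos (sub_pos.2 hlt) (sub_pos.2 hlt)]

variable [CompleteSpace H]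

/-- Stability under contractions is the advantage of Bessel families over orthonormal ones as test
vectors. -/
theorem map (hu : IsBesselFamily u) {W : H →L[ℂ] H} (hW : ‖W‖ ≤ 1) :
    IsBesselFamily fun i => W (u i) := by
  intro x
  simp only [← ContinuousLinearMap.adjoint_inner_right]
  refine (hu _).trans ?_
  have h := (ContinuousLinearMap.adjoint W).le_opNorm x
  rw [LinearIsometryEquiv.norm_map] at h
  have h2 : ‖ContinuousLinearMap.adjoint W x‖ ≤ ‖x‖ :=
    h.trans (mul_le_of_le_one_left (norm_nonneg _) hW)
  gcongr

end IsBesselFamily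

variable [CompleteSpace H]

/-- The maximum in the variational formula is attained at the leading Schmidt vectors. Only `min k
r` of them are needed, as later singular values vanish. -/
theorem IsSchmidt.sum_singularValue {T : H →L[ℂ] H} {r : ℕ} {s : Fin r → ℝ} {e f : Fin r → H}
    (h : IsSchmidt T s e f) (k : ℕ) :
    ∃ l ≤ k, ∃ u v : Fin l → H, IsBesselFamily u ∧ IsBesselFamily v ∧
      ∑ j ∈ Finset.range k, singularValue T j = ∑ i, (⟪v i, T (u i)⟫_ℂ).re := by
  have hl : min k r ≤ r := min_le_right _ _
  have he := h.orthonormal_left.comp _ (Fin.castLE_injective hl)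
  have hf := h.orthonormal_right.comp _ (Fin.castLE_injective hl)
  refine ⟨min k r, min_le_left _ _, e ∘ Fin.castLE hl, f ∘ Fin.castLE hl,
    he.isBesselFamily, hf.isBesselFamily, ?_⟩
  have hTe : ∀ i, T (e i) = (s i : ℂ) • f i := by
    intro i
    rw [h.apply_eq, Finset.sum_eq_single i]
    · rw [orthonormal_iff_ite.1 h.orthonormal_left]; simp
    · intro j _ hj
      rw [orthonormal_iff_ite.1 h.orthonormal_left]; simp [hj]
    · simp
  rw [← Finset.sum_subset (Finset.range_subset_range.2 (min_le_left k r)), Finset.sum_range]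
  · refine Finset.sum_congr rfl fun i _ => ?_
    have hi : (i : ℕ) < r := i.2.trans_le hl
    rw [h.singularValue_eq, dif_pos hi, Function.comp, Function.comp, hTe, inner_smul_right,
      orthonormal_iff_ite.1 h.orthonormal_right]
    simp [Fin.castLE]
  · intro j hj hj'
    simp only [Finset.mem_range, lt_min_iff, not_and, not_lt] at hj hj'
    rw [h.singularValue_eq, dif_neg (not_lt.2 (hj' hj))]

/-- Expand `T` in its Schmidt vectors and bound each product of two inner products by the mean of
the squares. Bessel's inequality, used in both directions, makes the resulting weights at most `1`
with total at most `k`, so `sum_mul_le_sum_range` applies. -/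
theorem IsSchmidt.sum_re_inner_le {T : H →L[ℂ] H} {r : ℕ} {s : Fin r → ℝ} {e f : Fin r → H}
    (h : IsSchmidt T s e f) {l k : ℕ} (hl : l ≤ k) {u v : Fin l → H} (hu : IsBesselFamily u)
    (hv : IsBesselFamily v) :
    ∑ i, (⟪v i, T (u i)⟫_ℂ).re ≤ ∑ j ∈ Finset.range k, singularValue T j := by
  let d' : Fin r → ℝ := fun j => (∑ i, ‖⟪u i, e j⟫_ℂ‖ ^ 2 + ∑ i, ‖⟪v i, f j⟫_ℂ‖ ^ 2) / 2
  let d : ℕ → ℝ := fun j => if hj : j < r then d' ⟨j, hj⟩ else 0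
  have hd'0 : ∀ j, 0 ≤ d' j := fun j => by positivity
  have hd'1 : ∀ j, d' j ≤ 1 := fun j => by
    have h1 := hu (e j)
    have h2 := hv (f j)
    rw [h.orthonormal_left.1] at h1
    rw [h.orthonormal_right.1] at h2
    simp only [d']
    linarith
  have hsum : ∀ {g : Fin r → H} {w : Fin l → H}, Orthonormal ℂ g → IsBesselFamily w →
      ∑ j, ∑ i, ‖⟪w i, g j⟫_ℂ‖ ^ 2 ≤ k := by
    intro g w hg hw
    rw [Finset.sum_comm]
    calc ∑ i, ∑ j, ‖⟪w i, g j⟫_ℂ‖ ^ 2 ≤ ∑ _i : Fin l, (1 : ℝ) := by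
          refine Finset.sum_le_sum fun i _ => ?_
          simp only [norm_inner_symm (w i)]
          refine (hg.isBesselFamily (w i)).trans ?_
          have := hw.norm_le_one i
          exact pow_le_one₀ (norm_nonneg _) this
      _ ≤ k := by simpa using hl
  have hdk : ∑ j ∈ Finset.range r, d j ≤ k := by
    have : ∑ j ∈ Finset.range r, d j = ∑ j, d' j := by
      rw [Finset.sum_range]; simp [d]
    rw [this, ← Finset.sum_div, Finset.sum_add_distrib]
    linarith [hsum h.orthonormal_left hu, hsum h.orthonormal_right hv]
  have hmain := sum_mul_le_sum_range (k := k) h.singularValue_antitone h.singularValue_nonneg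
    (r := r) (d := d) (fun j => by simp only [d]; split_ifs; exacts [hd'0 _, le_rfl])
    (fun j => by simp only [d]; split_ifs; exacts [hd'1 _, zero_le_one]) hdk
  refine le_trans ?_ hmain
  have hR : ∑ j ∈ Finset.range r, singularValue T j * d j = ∑ j, s j * d' j := by
    rw [Finset.sum_range]
    refine Finset.sum_congr rfl fun j _ => ?_
    rw [h.singularValue_eq]; simp [d]
  rw [hR]
  have hL : ∑ i, (⟪v i, T (u i)⟫_ℂ).re
      = ∑ j, ∑ i, s j * (⟪e j, u i⟫_ℂ * ⟪v i, f j⟫_ℂ).re := by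
    rw [Finset.sum_comm]
    refine Finset.sum_congr rfl fun i _ => ?_
    rw [h.apply_eq, inner_sum, Complex.re_sum]
    refine Finset.sum_congr rfl fun j _ => ?_
    rw [inner_smul_right, inner_smul_right, Complex.re_ofReal_mul]
  rw [hL]
  refine Finset.sum_le_sum fun j _ => ?_
  rw [← Finset.mul_sum]
  refine mul_le_mul_of_nonneg_left ?_ (h.pos j).le
  simp only [d']
  rw [← Finset.sum_add_distrib, Finset.sum_div]
  refine Finset.sum_le_sum fun i _ => ?_
  refine (Complex.re_le_norm _).trans ?_
  rw [norm_mul, norm_inner_symm (e j)]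
  nlinarith [sq_nonneg (‖⟪u i, e j⟫_ℂ‖ - ‖⟪v i, f j⟫_ℂ‖)]

namespace IsFiniteRank

variable {S T : H →L[ℂ] H}

theorem exists_isSchmidt (hT : IsFiniteRank T) :
    ∃ (r : ℕ) (s : Fin r → ℝ) (e f : Fin r → H), IsSchmidt T s e f := by
  unfold IsFiniteRank at hT
  exact _root_.exists_isSchmidt T

theorem singularValue_nonneg (hT : IsFiniteRank T) (j : ℕ) : 0 ≤ singularValue T j := by
  obtain ⟨r, s, e, f, h⟩ := hT.exists_isSchmidt
  exact h.singularValue_nonneg j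

theorem singularValue_antitone (hT : IsFiniteRank T) : Antitone (singularValue T) := by
  obtain ⟨r, s, e, f, h⟩ := hT.exists_isSchmidt
  exact h.singularValue_antitone

theorem sum_singularValue (hT : IsFiniteRank T) (k : ℕ) :
    ∃ l ≤ k, ∃ u v : Fin l → H, IsBesselFamily u ∧ IsBesselFamily v ∧
      ∑ j ∈ Finset.range k, singularValue T j = ∑ i, (⟪v i, T (u i)⟫_ℂ).re := by
  obtain ⟨r, s, e, f, h⟩ := hT.exists_isSchmidt
  exact h.sum_singularValue k

theorem sum_re_inner_le (hT : IsFiniteRank T) {l k : ℕ} (hl : l ≤ k) {u v : Fin l → H}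
    (hu : IsBesselFamily u) (hv : IsBesselFamily v) :
    ∑ i, (⟪v i, T (u i)⟫_ℂ).re ≤ ∑ j ∈ Finset.range k, singularValue T j := by
  obtain ⟨r, s, e, f, h⟩ := hT.exists_isSchmidt
  exact h.sum_re_inner_le hl hu hv

theorem singularValue_zero_le (hT : IsFiniteRank T) : singularValue T 0 ≤ ‖T‖ := by
  obtain ⟨l, hl, u, v, hu, hv, h⟩ := hT.sum_singularValue 1
  rw [Finset.sum_range_one] at h
  rw [h]
  calc ∑ i, (⟪v i, T (u i)⟫_ℂ).re ≤ ∑ _i : Fin l, ‖T‖ := by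
        refine Finset.sum_le_sum fun i _ => (Complex.re_le_norm _).trans ?_
        refine (norm_inner_le_norm _ _).trans ?_
        refine (mul_le_of_le_one_left (norm_nonneg _) (hv.norm_le_one i)).trans ?_
        exact (T.le_opNorm _).trans (mul_le_of_le_one_right (norm_nonneg _) (hu.norm_le_one i))
    _ ≤ ‖T‖ := by
        have : (l : ℝ) ≤ 1 := by exact_mod_cast hl
        simpa using mul_le_of_le_one_left (norm_nonneg T) this

/-- Test vectors optimal for the sum are admissible for each summand; scaling and multiplication by
contractions are treated in the same way. -/
theorem sum_singularValue_add_le (hS : IsFiniteRank S) (hT : IsFiniteRank T) (k : ℕ) :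
    ∑ j ∈ Finset.range k, singularValue (S + T) j ≤
      ∑ j ∈ Finset.range k, (singularValue S j + singularValue T j) := by
  obtain ⟨l, hl, u, v, hu, hv, h⟩ := (hS.add hT).sum_singularValue k
  rw [h, Finset.sum_add_distrib]
  simp only [add_apply, inner_add_right, Complex.add_re,
    Finset.sum_add_distrib]
  exact add_le_add (hS.sum_re_inner_le hl hu hv) (hT.sum_re_inner_le hl hu hv)

theorem sum_singularValue_smul_le (hT : IsFiniteRank T) {c : ℝ} (hc : 0 ≤ c) (k : ℕ) :
    ∑ j ∈ Finset.range k, singularValue ((c : ℂ) • T) j ≤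
      ∑ j ∈ Finset.range k, c * singularValue T j := by
  obtain ⟨l, hl, u, v, hu, hv, h⟩ := (hT.smul (c : ℂ)).sum_singularValue k
  rw [h, ← Finset.mul_sum]
  simp only [smul_apply, inner_smul_right, Complex.re_ofReal_mul,
    ← Finset.mul_sum]
  exact mul_le_mul_of_nonneg_left (hT.sum_re_inner_le hl hu hv) hc

theorem sum_singularValue_mul_le (hT : IsFiniteRank T) {U V : H →L[ℂ] H} (hU : ‖U‖ ≤ 1)
    (hV : ‖V‖ ≤ 1) (k : ℕ) :
    ∑ j ∈ Finset.range k, singularValue (U * T * V) j ≤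
      ∑ j ∈ Finset.range k, singularValue T j := by
  obtain ⟨l, hl, u, v, hu, hv, h⟩ := ((hT.mul_left U).mul_right V).sum_singularValue k
  have hU' : ‖ContinuousLinearMap.adjoint U‖ ≤ 1 := by rwa [LinearIsometryEquiv.norm_map]
  rw [h]
  refine le_trans (le_of_eq ?_) (hT.sum_re_inner_le hl (hu.map hV) (hv.map hU'))
  refine Finset.sum_congr rfl fun i _ => ?_
  rw [ContinuousLinearMap.adjoint_inner_left]
  rfl

end IsFiniteRank

/-! ### The two families of norms are symmetric -/

theorem SymmetricNormingFunction.opNorm_of_isFiniteRank (Φ : SymmetricNormingFunction)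
    {T : H →L[ℂ] H} (hT : IsFiniteRank T) :
    Φ.opNorm T = ⨆ N, ENNReal.ofReal (Φ.toFun (ofFin N fun i => singularValue T i)) := by
  rw [opNorm, if_pos hT.isCompactOperator]
  simp only [sum_single_eq_ofFin]

theorem SymmetricNormingFunction.isSymmetricIdealNorm_opNorm (Φ : SymmetricNormingFunction) :
    IsSymmetricIdealNorm (Φ.opNorm : (H →L[ℂ] H) → ℝ≥0∞) where
  add_le {S T} hS hT := by
    rw [Φ.opNorm_of_isFiniteRank hS, Φ.opNorm_of_isFiniteRank hT,
      Φ.opNorm_of_isFiniteRank (hS.add hT)]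
    refine iSup_le fun N => ?_
    have h1 := Φ.toFun_ofFin_le (N := N) (hS.add hT).singularValue_antitone
      (hS.add hT).singularValue_nonneg
      (fun j => add_nonneg (hS.singularValue_nonneg j) (hT.singularValue_nonneg j))
      (hS.sum_singularValue_add_le hT)
    have h2 := Φ.add_le' (ofFin N fun i => singularValue S i) (ofFin N fun i => singularValue T i)
    rw [← map_add] at h2
    refine (ENNReal.ofReal_le_ofReal (h1.trans h2)).trans (ENNReal.ofReal_add_le.trans ?_)
    exact add_le_add
      (le_iSup (fun N => ENNReal.ofReal (Φ.toFun (ofFin N fun i => singularValue S i))) N)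
      (le_iSup (fun N => ENNReal.ofReal (Φ.toFun (ofFin N fun i => singularValue T i))) N)
  smul_le {T c} hT hc := by
    rw [Φ.opNorm_of_isFiniteRank hT, Φ.opNorm_of_isFiniteRank (hT.smul c)]
    refine iSup_le fun N => ?_
    have h1 := Φ.toFun_ofFin_le (N := N) (hT.smul (c : ℂ)).singularValue_antitone
      (hT.smul (c : ℂ)).singularValue_nonneg
      (fun j => mul_nonneg hc (hT.singularValue_nonneg j)) (hT.sum_singularValue_smul_le hc)
    have h2 := Φ.smul' c (ofFin N fun i => singularValue T i)
    rw [← map_smul, abs_of_nonneg hc] at h2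
    refine (ENNReal.ofReal_le_ofReal (h1.trans h2.le)).trans ?_
    rw [ENNReal.ofReal_mul hc]
    gcongr
    exact le_iSup (fun N => ENNReal.ofReal (Φ.toFun (ofFin N fun i => singularValue T i))) N
  mul_le {U T V} hT hU hV := by
    have hUTV := (hT.mul_left U).mul_right V
    rw [Φ.opNorm_of_isFiniteRank hT, Φ.opNorm_of_isFiniteRank hUTV]
    exact iSup_mono fun N => ENNReal.ofReal_le_ofReal (Φ.toFun_ofFin_le
      hUTV.singularValue_antitone hUTV.singularValue_nonneg hT.singularValue_nonneg
      (hT.sum_singularValue_mul_le hU hV))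

theorem one_sub_toReal_inv_nonneg {p : ℝ≥0∞} (hp : 1 ≤ p) : 0 ≤ 1 - p⁻¹.toReal := by
  have : p⁻¹.toReal ≤ (1 : ℝ≥0∞).toReal :=
    ENNReal.toReal_mono ENNReal.one_ne_top (ENNReal.inv_le_one.2 hp)
  simpa using this

/-- For `α ≥ 0` the weights decrease, so Abel summation applies to every partial sum. -/
theorem tsum_div_rpow_le {x y : ℕ → ℝ} {α : ℝ} (hα : 0 ≤ α) (hx0 : ∀ j, 0 ≤ x j)
    (hy0 : ∀ j, 0 ≤ y j)
    (h : ∀ k, ∑ j ∈ Finset.range k, x j ≤ ∑ j ∈ Finset.range k, y j) :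
    ∑' j : ℕ, ENNReal.ofReal (x j / ((j : ℝ) + 1) ^ α) ≤
      ∑' j : ℕ, ENNReal.ofReal (y j / ((j : ℝ) + 1) ^ α) := by
  have hw0 : ∀ j : ℕ, 0 ≤ (((j : ℝ) + 1) ^ α)⁻¹ := fun j => by positivity
  have hw : Antitone fun j : ℕ => (((j : ℝ) + 1) ^ α)⁻¹ := by
    intro i j hij
    have : (i : ℝ) ≤ j := by exact_mod_cast hij
    simp only
    gcongr
  rw [ENNReal.tsum_eq_iSup_nat, ENNReal.tsum_eq_iSup_nat]
  refine iSup_mono fun N => ?_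
  rw [← ENNReal.ofReal_sum_of_nonneg fun j _ => div_nonneg (hx0 j) (by positivity),
    ← ENNReal.ofReal_sum_of_nonneg fun j _ => div_nonneg (hy0 j) (by positivity)]
  refine ENNReal.ofReal_le_ofReal ?_
  simpa only [div_eq_inv_mul] using sum_mul_le_sum_mul_of_partialSums hw hw0 h N

theorem lorentzNorm_of_isFiniteRank (p : ℝ≥0∞) {T : H →L[ℂ] H} (hT : IsFiniteRank T) :
    lorentzNorm p T =
      ∑' j : ℕ, ENNReal.ofReal (singularValue T j / ((j : ℝ) + 1) ^ (1 - p⁻¹.toReal)) := by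
  rw [lorentzNorm, if_pos hT.isCompactOperator]

theorem isSymmetricIdealNorm_lorentzNorm {p : ℝ≥0∞} (hp : 1 ≤ p) :
    IsSymmetricIdealNorm (lorentzNorm p : (H →L[ℂ] H) → ℝ≥0∞) where
  add_le {S T} hS hT := by
    rw [lorentzNorm_of_isFiniteRank p hS, lorentzNorm_of_isFiniteRank p hT,
      lorentzNorm_of_isFiniteRank p (hS.add hT), ← ENNReal.tsum_add]
    refine (tsum_div_rpow_le (one_sub_toReal_inv_nonneg hp) (hS.add hT).singularValue_nonneg
      (fun j => add_nonneg (hS.singularValue_nonneg j) (hT.singularValue_nonneg j))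
      (hS.sum_singularValue_add_le hT)).trans ?_
    refine ENNReal.tsum_le_tsum fun j => ?_
    rw [add_div]
    exact ENNReal.ofReal_add_le
  smul_le {T c} hT hc := by
    rw [lorentzNorm_of_isFiniteRank p hT, lorentzNorm_of_isFiniteRank p (hT.smul c),
      ← ENNReal.tsum_mul_left]
    refine (tsum_div_rpow_le (one_sub_toReal_inv_nonneg hp) (hT.smul (c : ℂ)).singularValue_nonneg
      (fun j => mul_nonneg hc (hT.singularValue_nonneg j))
      (hT.sum_singularValue_smul_le hc)).trans ?_
    refine ENNReal.tsum_le_tsum fun j => ?_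
    rw [mul_div_assoc, ENNReal.ofReal_mul hc]
  mul_le {U T V} hT hU hV := by
    have hUTV := (hT.mul_left U).mul_right V
    rw [lorentzNorm_of_isFiniteRank p hT, lorentzNorm_of_isFiniteRank p hUTV]
    exact tsum_div_rpow_le (one_sub_toReal_inv_nonneg hp) hUTV.singularValue_nonneg
      hT.singularValue_nonneg (hT.sum_singularValue_mul_le hU hV)

end KyFan

/-! ### Block diagonal operators -/

section BlockDiagonal

variable {H K : Type*} [NormedAddCommGroup H] [InnerProductSpace ℂ H] [CompleteSpace H]
  [NormedAddCommGroup K] [InnerProductSpace ℂ K] [CompleteSpace K] {m : ℕ}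

open ContinuousLinearMap (adjoint)

/-- The maps `ι j` are isometries with orthogonal ranges that sum up to the whole space; they
identify the space `K` with the direct sum of `m` copies of `H`. -/
structure IsSlicing (ι : Fin m → H →L[ℂ] K) : Prop where
  adjoint_apply : ∀ j k x, adjoint (ι j) (ι k x) = if j = k then x else 0
  sum_apply : ∀ x, ∑ j, ι j (adjoint (ι j) x) = x

/-- The block diagonal operator with blocks `X j`. -/
noncomputable def blockDiag (ι : Fin m → H →L[ℂ] K) (X : Fin m → H →L[ℂ] H) : K →L[ℂ] K :=
  ∑ j, ι j ∘L X j ∘L adjoint (ι j)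

/-- The `j`-th diagonal block of an operator. -/
noncomputable def diagBlock (ι : Fin m → H →L[ℂ] K) (X : K →L[ℂ] K) (j : Fin m) : H →L[ℂ] H :=
  adjoint (ι j) ∘L X ∘L ι j

/-- The operator permuting the copies of `H`. -/
noncomputable def blockPerm (ι : Fin m → H →L[ℂ] K) (σ : Equiv.Perm (Fin m)) : K →L[ℂ] K :=
  ∑ j, ι (σ j) ∘L adjoint (ι j)

theorem blockDiag_apply (ι : Fin m → H →L[ℂ] K) (X : Fin m → H →L[ℂ] H) (x : K) :
    blockDiag ι X x = ∑ j, ι j (X j (adjoint (ι j) x)) := by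
  simp [blockDiag]

theorem blockDiag_sub (ι : Fin m → H →L[ℂ] K) (X Y : Fin m → H →L[ℂ] H) :
    blockDiag ι X - blockDiag ι Y = blockDiag ι (fun j => X j - Y j) := by
  ext x
  simp [blockDiag_apply]

theorem isFiniteRank_blockDiag (ι : Fin m → H →L[ℂ] K) {X : Fin m → H →L[ℂ] H}
    (hX : ∀ j, IsFiniteRank (X j)) : IsFiniteRank (blockDiag ι X) :=
  IsFiniteRank.sum _ fun j _ => ((hX j).comp_right _).comp_left _

theorem isFiniteRank_diagBlock (ι : Fin m → H →L[ℂ] K) {X : K →L[ℂ] K} (hX : IsFiniteRank X)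
    (j : Fin m) : IsFiniteRank (diagBlock ι X j) :=
  (hX.comp_right _).comp_left _

theorem isPositive_blockDiag (ι : Fin m → H →L[ℂ] K) {X : Fin m → H →L[ℂ] H}
    (hX : ∀ j, (X j).IsPositive) : (blockDiag ι X).IsPositive :=
  ContinuousLinearMap.isPositive_sum _ fun j _ => (hX j).conj_adjoint (ι j)

theorem isPositive_diagBlock (ι : Fin m → H →L[ℂ] K) {X : K →L[ℂ] K} (hX : X.IsPositive)
    (j : Fin m) : (diagBlock ι X j).IsPositive :=
  hX.adjoint_conj (ι j)

namespace IsSlicing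

variable {ι : Fin m → H →L[ℂ] K}

theorem sum_norm_sq (h : IsSlicing ι) (x : K) : ∑ j, ‖adjoint (ι j) x‖ ^ 2 = ‖x‖ ^ 2 := by
  have h1 : ⟪x, x⟫_ℂ = ∑ j, ⟪adjoint (ι j) x, adjoint (ι j) x⟫_ℂ := by
    conv_lhs => rw [← h.sum_apply x, sum_inner]
    refine Finset.sum_congr rfl fun j _ => ?_
    rw [← ContinuousLinearMap.adjoint_inner_right, h.sum_apply]
  simp only [inner_self_eq_norm_sq_to_K] at h1
  exact_mod_cast h1.symm

theorem norm_apply (h : IsSlicing ι) (j : Fin m) (x : H) : ‖ι j x‖ = ‖x‖ := by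
  have h1 : ⟪ι j x, ι j x⟫_ℂ = ⟪x, x⟫_ℂ := by
    rw [← ContinuousLinearMap.adjoint_inner_right, h.adjoint_apply, if_pos rfl]
  rw [inner_self_eq_norm_sq_to_K, inner_self_eq_norm_sq_to_K] at h1
  have h2 : ‖ι j x‖ ^ 2 = ‖x‖ ^ 2 := by exact_mod_cast h1
  exact (sq_eq_sq₀ (norm_nonneg _) (norm_nonneg _)).1 h2

theorem norm_le_one (h : IsSlicing ι) (j : Fin m) : ‖ι j‖ ≤ 1 :=
  ContinuousLinearMap.opNorm_le_bound _ zero_le_one fun x => by rw [h.norm_apply, one_mul]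

theorem ext_vector (h : IsSlicing ι) {x y : K} (hxy : ∀ j, adjoint (ι j) x = adjoint (ι j) y) :
    x = y := by
  rw [← h.sum_apply x, ← h.sum_apply y]
  simp only [hxy]

theorem ext_operator (h : IsSlicing ι) {S T : K →L[ℂ] K}
    (hST : ∀ j k x, adjoint (ι j) (S (ι k x)) = adjoint (ι j) (T (ι k x))) : S = T := by
  ext x
  rw [← h.sum_apply x, map_sum, map_sum]
  exact Finset.sum_congr rfl fun k _ => h.ext_vector fun j => hST j k _

theorem adjoint_blockDiag (h : IsSlicing ι) (X : Fin m → H →L[ℂ] H) (k : Fin m) (x : K) :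
    adjoint (ι k) (blockDiag ι X x) = X k (adjoint (ι k) x) := by
  rw [blockDiag_apply, map_sum, Finset.sum_eq_single k]
  · rw [h.adjoint_apply, if_pos rfl]
  · intro j _ hj
    rw [h.adjoint_apply, if_neg hj.symm]
  · simp

theorem blockDiag_slice (h : IsSlicing ι) (X : Fin m → H →L[ℂ] H) (k : Fin m) (x : H) :
    blockDiag ι X (ι k x) = ι k (X k x) := by
  refine h.ext_vector fun j => ?_
  rw [h.adjoint_blockDiag, h.adjoint_apply, h.adjoint_apply]
  split_ifs with hjk
  · rw [hjk]
  · simp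

theorem blockDiag_mul (h : IsSlicing ι) (X Y : Fin m → H →L[ℂ] H) :
    blockDiag ι X * blockDiag ι Y = blockDiag ι (fun j => X j * Y j) := by
  ext x
  refine h.ext_vector fun j => ?_
  simp only [mul_apply_eq_comp, h.adjoint_blockDiag]

theorem norm_blockDiag_le (h : IsSlicing ι) {X : Fin m → H →L[ℂ] H} {C : ℝ}
    (hC : 0 ≤ C) (hX : ∀ j, ‖X j‖ ≤ C) : ‖blockDiag ι X‖ ≤ C := by
  refine ContinuousLinearMap.opNorm_le_bound _ hC fun x => ?_
  refine le_of_sq_le_sq ?_ (by positivity)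
  rw [← h.sum_norm_sq, mul_pow, ← h.sum_norm_sq x, Finset.mul_sum]
  refine Finset.sum_le_sum fun j _ => ?_
  rw [h.adjoint_blockDiag, ← mul_pow]
  have := (X j).le_of_opNorm_le (hX j) (adjoint (ι j) x)
  gcongr

theorem norm_diagBlock_le (h : IsSlicing ι) (X : K →L[ℂ] K) (j : Fin m) : ‖diagBlock ι X j‖ ≤ ‖X‖ := by
  have h1 := h.norm_le_one j
  have h2 : ‖adjoint (ι j)‖ ≤ 1 := by rwa [LinearIsometryEquiv.norm_map]
  calc ‖diagBlock ι X j‖ ≤ ‖adjoint (ι j)‖ * (‖X‖ * ‖ι j‖) :=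
        (ContinuousLinearMap.opNorm_comp_le _ _).trans
          (mul_le_mul_of_nonneg_left (ContinuousLinearMap.opNorm_comp_le _ _) (norm_nonneg _))
    _ ≤ 1 * (‖X‖ * 1) := by gcongr
    _ = ‖X‖ := by ring

/-- Compression to a diagonal block turns multiplication by a block diagonal operator into
multiplication by its block. -/
theorem diagBlock_commutator (h : IsSlicing ι) (X : Fin m → H →L[ℂ] H) (A : K →L[ℂ] K) (j : Fin m) :
    diagBlock ι (blockDiag ι X * A - A * blockDiag ι X) j =
      X j * diagBlock ι A j - diagBlock ι A j * X j := by
  ext x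
  simp [diagBlock, h.blockDiag_slice, h.adjoint_blockDiag]

theorem adjoint_blockPerm (h : IsSlicing ι) (σ : Equiv.Perm (Fin m)) (k : Fin m) (x : K) :
    adjoint (ι k) (blockPerm ι σ x) = adjoint (ι (σ.symm k)) x := by
  have hx : blockPerm ι σ x = ∑ j, ι (σ j) (adjoint (ι j) x) := by simp [blockPerm]
  rw [hx, map_sum, Finset.sum_eq_single (σ.symm k)]
  · rw [h.adjoint_apply, Equiv.apply_symm_apply, if_pos rfl]
  · intro j _ hj
    rw [h.adjoint_apply, if_neg]
    rintro rfl
    exact hj (σ.symm_apply_apply j).symm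
  · simp

theorem norm_blockPerm_le (h : IsSlicing ι) (σ : Equiv.Perm (Fin m)) : ‖blockPerm ι σ‖ ≤ 1 := by
  refine ContinuousLinearMap.opNorm_le_bound _ zero_le_one fun x => ?_
  rw [one_mul]
  refine le_of_sq_le_sq ?_ (by positivity)
  rw [← h.sum_norm_sq, ← h.sum_norm_sq x]
  simp only [h.adjoint_blockPerm]
  exact (Equiv.sum_comp σ.symm fun k => ‖adjoint (ι k) x‖ ^ 2).le

theorem blockPerm_conj (h : IsSlicing ι) (σ : Equiv.Perm (Fin m)) (X : Fin m → H →L[ℂ] H) :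
    blockPerm ι σ * blockDiag ι X * blockPerm ι σ.symm = blockDiag ι (X ∘ σ.symm) := by
  ext x
  refine h.ext_vector fun j => ?_
  simp only [mul_apply_eq_comp, h.adjoint_blockDiag, h.adjoint_blockPerm, Equiv.symm_symm,
    Equiv.apply_symm_apply, Function.comp]

end IsSlicing

/-- Orthogonality of the characters of ℤ/m, through a geometric sum. -/
theorem sum_pow_mul_inv_pow_of_isPrimitiveRoot {ω : ℂ} (hω : IsPrimitiveRoot ω m)
    (j k : Fin m) :
    ∑ l : Fin m, ω ^ ((l : ℕ) * j) * ω⁻¹ ^ ((l : ℕ) * k) = if j = k then (m : ℂ) else 0 := by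
  have hm : m ≠ 0 := fun h0 => by subst h0; exact j.elim0
  have hω0 : ω ≠ 0 := hω.ne_zero hm
  have h1 : ∀ l : Fin m, ω ^ ((l : ℕ) * j) * ω⁻¹ ^ ((l : ℕ) * k) =
      (ω ^ (j : ℕ) * ω⁻¹ ^ (k : ℕ)) ^ (l : ℕ) := by
    intro l
    rw [mul_pow, ← pow_mul, ← pow_mul, mul_comm (l : ℕ), mul_comm (l : ℕ)]
  simp only [h1]
  rw [Fin.sum_univ_eq_sum_range (fun l => (ω ^ (j : ℕ) * ω⁻¹ ^ (k : ℕ)) ^ l)]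
  split_ifs with hjk
  · subst hjk
    rw [← mul_pow, mul_inv_cancel₀ hω0]
    simp
  · have hne : ω ^ (j : ℕ) * ω⁻¹ ^ (k : ℕ) ≠ 1 := by
      intro heq
      rw [inv_pow, mul_inv_eq_one₀ (pow_ne_zero _ hω0)] at heq
      exact hjk (Fin.ext (hω.pow_inj j.2 k.2 heq))
    rw [geom_sum_eq hne]
    have : (ω ^ (j : ℕ) * ω⁻¹ ^ (k : ℕ)) ^ m = 1 := by
      rw [mul_pow, ← pow_mul, ← pow_mul, mul_comm, mul_comm (k : ℕ), mul_comm (j : ℕ), pow_mul,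
        pow_mul, inv_pow, hω.pow_eq_one]
      simp
    rw [this, sub_self, zero_div]

/-! ### Pinching, averaging and rescaling of blocks -/

namespace IsSymmetricIdealNorm

variable {ν : (K →L[ℂ] K) → ℝ≥0∞} {ι : Fin m → H →L[ℂ] K}

/-- Pinching does not increase a symmetric norm. -/
theorem blockDiag_diagBlock_le (hν : IsSymmetricIdealNorm ν) (h : IsSlicing ι) (hm : 1 ≤ m)
    {X : K →L[ℂ] K} (hX : IsFiniteRank X) : ν (blockDiag ι (diagBlock ι X)) ≤ ν X := by
  have hm0 : m ≠ 0 := by omega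
  let ω : ℂ := Complex.exp (2 * Real.pi * Complex.I / m)
  have hω : IsPrimitiveRoot ω m := Complex.isPrimitiveRoot_exp m hm0
  have hω1 : ‖ω‖ = 1 := hω.norm'_eq_one hm0
  -- Conjugation by these diagonal unitaries multiplies block (j, k) by ω^(l(j-k)); averaging over
  -- `l` leaves only the diagonal blocks.
  let U : Fin m → K →L[ℂ] K := fun l => blockDiag ι fun j => (ω ^ ((l : ℕ) * j)) • 1
  let V : Fin m → K →L[ℂ] K := fun l => blockDiag ι fun j => (ω⁻¹ ^ ((l : ℕ) * j)) • 1
  have hone : ‖(1 : H →L[ℂ] H)‖ ≤ 1 := ContinuousLinearMap.norm_id_le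
  have hU : ∀ l, ‖U l‖ ≤ 1 := fun l => h.norm_blockDiag_le zero_le_one fun j => by
    rw [norm_smul, norm_pow, hω1, one_pow, one_mul]; exact hone
  have hV : ∀ l, ‖V l‖ ≤ 1 := fun l => h.norm_blockDiag_le zero_le_one fun j => by
    rw [norm_smul, norm_pow, norm_inv, hω1, inv_one, one_pow, one_mul]; exact hone
  have havg : blockDiag ι (diagBlock ι X) = ((m : ℝ)⁻¹ : ℝ) • ∑ l, U l * X * V l := by
    refine h.ext_operator fun j k x => ?_
    have hmC : (m : ℂ) ≠ 0 := by exact_mod_cast hm0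
    have h1 : ∀ l, adjoint (ι j) ((U l * X * V l) (ι k x)) =
        (ω ^ ((l : ℕ) * j) * ω⁻¹ ^ ((l : ℕ) * k)) • adjoint (ι j) (X (ι k x)) := by
      intro l
      simp only [mul_apply_eq_comp, U, V, h.adjoint_blockDiag, h.blockDiag_slice, smul_apply,
        one_apply_eq_self, map_smul, smul_smul]
      rw [mul_comm (ω⁻¹ ^ _)]
    rw [h.blockDiag_slice, h.adjoint_apply, ← Complex.coe_smul, smul_apply, map_smul, sum_apply,
      map_sum]
    simp only [h1]
    rw [← Finset.sum_smul, sum_pow_mul_inv_pow_of_isPrimitiveRoot hω]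
    split_ifs with hjk
    · subst hjk
      rw [smul_smul]
      simp [hmC, diagBlock]
    · simp
  rw [havg]
  exact hν.average_le hm (fun l => (hX.mul_left _).mul_right _)
    fun l => hν.mul_le hX (hU l) (hV l)

/-- Averaging the blocks does not increase a symmetric norm. -/
theorem blockDiag_average_le (hν : IsSymmetricIdealNorm ν) (h : IsSlicing ι) (hm : 1 ≤ m)
    {X : Fin m → H →L[ℂ] H} (hX : ∀ j, IsFiniteRank (X j)) :
    ν (blockDiag ι fun _ => ((m : ℝ)⁻¹ : ℝ) • ∑ j, X j) ≤ ν (blockDiag ι X) := by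
  have : NeZero m := ⟨by omega⟩
  -- Averaging over the cyclic shifts brings every block once into every position.
  let P : Fin m → K →L[ℂ] K := fun l =>
    blockPerm ι (Equiv.addRight l) * blockDiag ι X * blockPerm ι (Equiv.addRight l).symm
  have hP : ∀ l, P l = blockDiag ι (X ∘ (Equiv.addRight l).symm) := fun l =>
    h.blockPerm_conj _ _
  have havg : (blockDiag ι fun _ => ((m : ℝ)⁻¹ : ℝ) • ∑ j, X j) = ((m : ℝ)⁻¹ : ℝ) • ∑ l, P l := by
    ext x
    refine h.ext_vector fun k => ?_
    simp only [← Complex.coe_smul]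
    rw [h.adjoint_blockDiag, smul_apply, smul_apply, map_smul, sum_apply, sum_apply, map_sum]
    congr 1
    simp only [hP, h.adjoint_blockDiag, Function.comp]
    refine (Equiv.sum_comp (Equiv.subLeft k) fun i => X i (adjoint (ι k) x)).symm.trans ?_
    refine Finset.sum_congr rfl fun l _ => ?_
    simp [sub_eq_add_neg]
  rw [havg]
  have hfin := isFiniteRank_blockDiag ι hX
  exact hν.average_le hm (fun l => (hfin.mul_left _).mul_right _)
    fun l => hν.mul_le hfin (h.norm_blockPerm_le _) (h.norm_blockPerm_le _)

/-- A symmetric norm is monotone in the coefficients of the blocks. -/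
theorem blockDiag_smul_le (hν : IsSymmetricIdealNorm ν) (h : IsSlicing ι)
    {X : Fin m → H →L[ℂ] H} (hX : ∀ j, IsFiniteRank (X j)) {a b : Fin m → ℝ}
    (hab : ∀ j, |a j| ≤ |b j|) :
    ν (blockDiag ι fun j => (a j : ℂ) • X j) ≤ ν (blockDiag ι fun j => (b j : ℂ) • X j) := by
  -- Factor out the diagonal contraction with entries `a j / b j`. If `b j = 0`, then `a j = 0` and
  -- the quotient is `0` by convention.
  have heq : (blockDiag ι fun j => (a j : ℂ) • X j) =
      (blockDiag ι fun j => ((a j / b j : ℝ) : ℂ) • 1) *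
        (blockDiag ι fun j => (b j : ℂ) • X j) * 1 := by
    rw [mul_one, h.blockDiag_mul]
    congr 1
    ext j x
    by_cases hb : b j = 0
    · have : a j = 0 := by simpa [hb] using hab j
      simp [hb, this]
    · have : (b j : ℂ) ≠ 0 := by exact_mod_cast hb
      simp only [mul_apply_eq_comp, smul_apply, one_apply_eq_self, smul_smul]
      congr 1
      push_cast
      field_simp
  rw [heq]
  refine hν.mul_le (isFiniteRank_blockDiag ι fun j => (hX j).smul _)
    (h.norm_blockDiag_le zero_le_one fun j => ?_) ContinuousLinearMap.norm_id_le
  rw [norm_smul]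
  refine mul_le_one₀ ?_ (norm_nonneg _) ContinuousLinearMap.norm_id_le
  rw [Complex.norm_real, Real.norm_eq_abs, abs_div]
  exact div_le_one_of_le₀ (hab j) (abs_nonneg _)

end IsSymmetricIdealNorm

end BlockDiagonal

/-! ### The directed set of positive contractions of finite rank -/

section FiniteRankPosContraction

variable {H : Type*} [NormedAddCommGroup H] [InnerProductSpace ℂ H]

/-- A contraction dominating a projection fixes the range of the projection. -/
theorem ContinuousLinearMap.apply_eq_of_starProjection_le {A : H →L[ℂ] H} (hA1 : ‖A‖ ≤ 1)
    {F : Submodule ℂ H} [F.HasOrthogonalProjection] (hF : F.starProjection ≤ A) {x : H}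
    (hx : x ∈ F) : A x = x := by
  -- Domination gives ‖x‖² ≤ Re⟨Ax, x⟩; expanding ‖Ax - x‖² and using ‖Ax‖ ≤ ‖x‖ then forces it to
  -- vanish.
  have h1 := (ContinuousLinearMap.le_def _ _).1 hF |>.re_inner_nonneg_left x
  rw [sub_apply, Submodule.starProjection_eq_self_iff.2 hx, inner_sub_left, map_sub,
    inner_self_eq_norm_sq] at h1
  have h2 : ‖A x‖ ≤ ‖x‖ := by simpa using A.le_of_opNorm_le hA1 x
  have h3 := norm_sub_sq (𝕜 := ℂ) (A x) x
  have h4 : ‖A x‖ ^ 2 ≤ ‖x‖ ^ 2 := by gcongr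
  have h5 : ‖A x - x‖ ^ 2 = 0 := le_antisymm (by linarith) (sq_nonneg _)
  rw [sq_eq_zero_iff, norm_eq_zero, sub_eq_zero] at h5
  exact h5

/-- `X` acts inside `F` and `Y` inside its orthogonal complement, so Pythagoras applies to both
arguments and values. -/
theorem ContinuousLinearMap.norm_add_le_of_orthogonal {F : Submodule ℂ H}
    [F.HasOrthogonalProjection] {X Y : H →L[ℂ] H} {C : ℝ} (hC : 0 ≤ C) (hX : ‖X‖ ≤ C)
    (hY : ‖Y‖ ≤ C) (hX0 : ∀ x ∈ Fᗮ, X x = 0) (hXF : ∀ x, X x ∈ F) (hY0 : ∀ x ∈ F, Y x = 0)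
    (hYF : ∀ x, Y x ∈ Fᗮ) : ‖X + Y‖ ≤ C := by
  refine ContinuousLinearMap.opNorm_le_bound _ hC fun x => ?_
  refine le_of_sq_le_sq ?_ (by positivity)
  have hx := Submodule.starProjection_add_starProjection_orthogonal (K := F) x
  have h1 : X x = X (F.starProjection x) := by
    conv_lhs => rw [← hx, map_add, hX0 _ (Submodule.starProjection_apply_mem _ _), add_zero]
  have h2 : Y x = Y (Fᗮ.starProjection x) := by
    conv_lhs => rw [← hx, map_add, hY0 _ (Submodule.starProjection_apply_mem _ _), zero_add]
  have h3 := norm_add_sq_eq_norm_sq_add_norm_sq_of_inner_eq_zero (𝕜 := ℂ) (X x) (Y x)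
    (hYF x _ (hXF x))
  have h4 := X.le_of_opNorm_le hX (F.starProjection x)
  have h5 := Y.le_of_opNorm_le hY (Fᗮ.starProjection x)
  rw [← h1] at h4
  rw [← h2] at h5
  have h6 : ‖X x‖ ^ 2 ≤ (C * ‖F.starProjection x‖) ^ 2 := by gcongr
  have h7 : ‖Y x‖ ^ 2 ≤ (C * ‖Fᗮ.starProjection x‖) ^ 2 := by gcongr
  rw [add_apply, mul_pow, F.norm_sq_eq_add_norm_sq_starProjection x]
  nlinarith

theorem FiniteRankPosContraction.isFiniteRank (A : FiniteRankPosContraction H) : IsFiniteRank A.1 := A.2.2.2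

variable [CompleteSpace H]

open ContinuousLinearMap (adjoint)

/-- A positive contraction is dominated by every projection that fixes its range. -/
theorem ContinuousLinearMap.IsPositive.le_of_mul_eq {A R : H →L[ℂ] H} (hA : A.IsPositive)
    (hA1 : ‖A‖ ≤ 1) (hR : R.IsPositive) (hRR : R * R = R) (hRA : R * A = A) : A ≤ R := by
  have hRx : ∀ x, ⟪R x, x⟫_ℂ = ⟪R x, R x⟫_ℂ := fun x => by
    conv_lhs => rw [← hRR, mul_apply_eq_comp, hR.inner_left_eq_inner_right]
  -- Taking adjoints in `R * A = A` reduces the comparison to vectors in the range of `R`, where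
  -- contractivity of `A` suffices.
  have hAR : ∀ x, A x = A (R x) := fun x => by
    refine ext_inner_right ℂ fun y => ?_
    conv_lhs => rw [hA.inner_left_eq_inner_right, ← hRA, mul_apply_eq_comp,
      ← hR.inner_left_eq_inner_right, ← hA.inner_left_eq_inner_right]
  have hAx : ∀ x, ⟪A x, x⟫_ℂ = ⟪A (R x), R x⟫_ℂ := fun x => by
    rw [← hR.inner_left_eq_inner_right, ← mul_apply_eq_comp, hRA, ← hAR]
  rw [ContinuousLinearMap.le_def, ContinuousLinearMap.isPositive_def']
  refine ⟨hR.isSelfAdjoint.sub hA.isSelfAdjoint, fun x => ?_⟩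
  rw [ContinuousLinearMap.reApplyInnerSelf_apply, sub_apply, inner_sub_left, map_sub, hRx, hAx,
    sub_nonneg]
  refine (RCLike.re_le_norm _).trans ((norm_inner_le_norm _ _).trans ?_)
  rw [inner_self_eq_norm_mul_norm]
  refine mul_le_mul_of_nonneg_right ?_ (norm_nonneg _)
  simpa using A.le_of_opNorm_le hA1 (R x)

namespace FiniteRankPosContraction

/-- The orthogonal projection onto a finite-dimensional subspace. -/
noncomputable def proj (F : Submodule ℂ H) [FiniteDimensional ℂ F] : FiniteRankPosContraction H :=
  ⟨F.starProjection, .of_isStarProjection isStarProjection_starProjection,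
    F.starProjection_norm_le, by
      rw [Submodule.range_starProjection]; infer_instance⟩

theorem le_proj {A : FiniteRankPosContraction H} {F : Submodule ℂ H} [FiniteDimensional ℂ F]
    (hF : A.1.range ≤ F) : A ≤ proj F := by
  refine A.2.1.le_of_mul_eq A.2.2.1 (proj F).2.1 F.isIdempotentElem_starProjection ?_
  ext x
  exact Submodule.starProjection_eq_self_iff.2 (hF ⟨x, rfl⟩)

instance : Nonempty (FiniteRankPosContraction H) := ⟨proj ⊥⟩

instance : IsDirectedOrder (FiniteRankPosContraction H) where
  directed A B := by
    have := A.2.2.2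
    have := B.2.2.2
    exact ⟨proj (A.1.range ⊔ B.1.range), le_proj le_sup_left, le_proj le_sup_right⟩

end FiniteRankPosContraction

/-! ### Comparison of lower limits -/

/-- The lower limit is the supremum of the infima over tails, so each far value of `g` need only be
matched by one value of `f` beyond `b₀`. -/
theorem mul_liminf_atTop_le {α β : Type*} [Preorder α] [IsDirectedOrder α] [Nonempty α]
    [Preorder β] [IsDirectedOrder β] [Nonempty β] {f : β → ℝ≥0∞} {g : α → ℝ≥0∞} {c d : ℝ≥0∞}
    (hd : d ≠ ∞) (h : ∀ b₀, ∃ a₁, ∀ a ≥ a₁, ∃ b ≥ b₀, c * f b ≤ d * g a) :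
    c * Filter.liminf f Filter.atTop ≤ d * Filter.liminf g Filter.atTop := by
  rw [Filter.atTop_basis.liminf_eq_iSup_iInf, Filter.atTop_basis.liminf_eq_iSup_iInf]
  simp only [iSup_true, ENNReal.mul_iSup]
  refine iSup_le fun b₀ => ?_
  obtain ⟨a₁, h₁⟩ := h b₀
  refine le_trans ?_ (le_iSup (fun a => d * ⨅ i ∈ Set.Ici a, g i) a₁)
  have key : ∀ a ≥ a₁, c * ⨅ b ∈ Set.Ici b₀, f b ≤ d * g a := by
    intro a ha
    obtain ⟨b, hb, hle⟩ := h₁ a ha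
    exact (mul_le_mul_right (iInf₂_le b hb) c).trans hle
  -- A finite nonzero factor passes through infima; for `d = 0` a single index suffices.
  rcases eq_or_ne d 0 with rfl | hd0
  · simpa using key a₁ le_rfl
  · rw [ENNReal.mul_iInf_of_ne hd0 hd]
    refine le_iInf fun a => ?_
    rw [ENNReal.mul_iInf_of_ne hd0 hd]
    exact le_iInf fun ha => key a ha

/-! ### Making the commutators small in operator norm -/

theorem norm_commutator_le (T : H →L[ℂ] H) {A : H →L[ℂ] H} (hA : ‖A‖ ≤ 1) :
    ‖T * A - A * T‖ ≤ 2 * ‖T‖ := by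
  have h1 : ‖T * A‖ ≤ ‖T‖ := (norm_mul_le _ _).trans (mul_le_of_le_one_right (norm_nonneg _) hA)
  have h2 : ‖A * T‖ ≤ ‖T‖ := (norm_mul_le _ _).trans (mul_le_of_le_one_left (norm_nonneg _) hA)
  linarith [norm_sub_le (T * A) (A * T)]

/-- Given a bound for a symmetric norm of commutators, attained arbitrarily far out in the directed
set, there are sums of `N` positive contractions satisfying this bound in the average whose
commutators are bounded in operator norm independently of `N`. -/
theorem IsSymmetricIdealNorm.exists_sum_norm_commutator_le {ν : (H →L[ℂ] H) → ℝ≥0∞}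
    (hν : IsSymmetricIdealNorm ν) {n : ℕ} (τ : Fin n → H →L[ℂ] H) {c : ℝ≥0∞}
    (hc : ∀ B : FiniteRankPosContraction H, ∃ A ≥ B, ∀ i, ν (τ i * A.1 - A.1 * τ i) ≤ c)
    (A₀ : FiniteRankPosContraction H) {C : ℝ} (hC0 : 0 ≤ C) (hC : ∀ i, 2 * ‖τ i‖ ≤ C) (N : ℕ) :
    ∃ S : H →L[ℂ] H, S.IsPositive ∧ ‖S‖ ≤ N ∧ IsFiniteRank S ∧
      (S - (N : ℂ) • A₀.1).IsPositive ∧ (∀ i, ν (τ i * S - S * τ i) ≤ N * c) ∧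
      ∀ i, ‖τ i * S - S * τ i‖ ≤ C := by
  induction N with
  | zero =>
    refine ⟨0, ContinuousLinearMap.isPositive_zero, by simp, .zero, by simp, fun i => ?_, fun i => ?_⟩
    · simpa using hν.map_zero_le
    · simpa using hC0
  | succ N ih =>
    obtain ⟨S, hSpos, hSN, hSfin, hSA, hSν, hSC⟩ := ih
    have hS' : FiniteDimensional ℂ S.range := hSfin
    have hA₀' : FiniteDimensional ℂ A₀.1.range := A₀.2.2.2
    -- The commutators of `S` live on `F`. If `A` is the identity on `G`, its commutators vanish on
    -- `F` and map into the orthogonal complement of `F`. Including the range of `A₀` in `G` ensures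
    -- `A₀ ≤ A`.
    let F : Submodule ℂ H := S.range ⊔ (⨆ i, S.range.map (τ i : H →ₗ[ℂ] H)) ⊔
      ⨆ i, S.range.map (adjoint (τ i) : H →ₗ[ℂ] H)
    let G : Submodule ℂ H := F ⊔ (⨆ i, F.map (τ i : H →ₗ[ℂ] H)) ⊔
      (⨆ i, F.map (adjoint (τ i) : H →ₗ[ℂ] H)) ⊔ A₀.1.range
    have hFS : ∀ x, S x ∈ F := fun x =>
      (le_sup_left.trans le_sup_left : S.range ≤ F) ⟨x, rfl⟩
    have hFτ : ∀ i x, τ i (S x) ∈ F := fun i x =>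
      ((le_iSup (fun i => S.range.map (τ i : H →ₗ[ℂ] H)) i).trans
        (le_sup_right.trans le_sup_left) : S.range.map (τ i : H →ₗ[ℂ] H) ≤ F)
        ⟨S x, ⟨x, rfl⟩, rfl⟩
    have hFτ' : ∀ i x, adjoint (τ i) (S x) ∈ F := fun i x =>
      ((le_iSup (fun i => S.range.map (adjoint (τ i) : H →ₗ[ℂ] H)) i).trans
        le_sup_right : S.range.map (adjoint (τ i) : H →ₗ[ℂ] H) ≤ F)
        ⟨S x, ⟨x, rfl⟩, rfl⟩
    have hGF : ∀ x ∈ F, x ∈ G := fun x hx =>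
      (le_sup_left.trans (le_sup_left.trans le_sup_left) : F ≤ G) hx
    have hGτ : ∀ i, ∀ x ∈ F, τ i x ∈ G := fun i x hx =>
      ((le_iSup (fun i => F.map (τ i : H →ₗ[ℂ] H)) i).trans
        (le_sup_right.trans (le_sup_left.trans le_sup_left)) : F.map (τ i : H →ₗ[ℂ] H) ≤ G)
        ⟨x, hx, rfl⟩
    have hGτ' : ∀ i, ∀ x ∈ F, adjoint (τ i) x ∈ G := fun i x hx =>
      ((le_iSup (fun i => F.map (adjoint (τ i) : H →ₗ[ℂ] H)) i).trans
        (le_sup_right.trans le_sup_left) : F.map (adjoint (τ i) : H →ₗ[ℂ] H) ≤ G)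
        ⟨x, hx, rfl⟩
    obtain ⟨A, hAG, hAν⟩ := hc (.proj G)
    have hAA₀ : A₀ ≤ A := (FiniteRankPosContraction.le_proj le_sup_right).trans hAG
    have hA : ∀ x ∈ G, A.1 x = x := fun x hx =>
      ContinuousLinearMap.apply_eq_of_starProjection_le A.2.2.1 hAG hx
    have hcomm : ∀ i, τ i * (S + A.1) - (S + A.1) * τ i =
        (τ i * S - S * τ i) + (τ i * A.1 - A.1 * τ i) := fun i => by noncomm_ring
    refine ⟨S + A.1, hSpos.add A.2.1, ?_, hSfin.add A.isFiniteRank, ?_, fun i => ?_, fun i => ?_⟩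
    · push_cast
      exact (norm_add_le _ _).trans (add_le_add hSN A.2.2.1)
    · have := hSA.add ((ContinuousLinearMap.le_def _ _).1 hAA₀)
      convert! this using 1
      push_cast
      rw [add_smul, one_smul]
      abel
    · rw [hcomm]
      push_cast
      rw [add_mul, one_mul]
      exact (hν.add_le (hSfin.commutator _) (A.isFiniteRank.commutator _)).trans
        (add_le_add (hSν i) (hAν i))
    · rw [hcomm]
      refine ContinuousLinearMap.norm_add_le_of_orthogonal (F := F) hC0 (hSC i)
        ((norm_commutator_le _ A.2.2.1).trans (hC i)) (fun x hx => ?_) (fun x => ?_)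
        (fun x hx => ?_) (fun x => ?_)
      · have h1 : S x = 0 := by
          refine ext_inner_left ℂ fun z => ?_
          rw [← hSpos.inner_left_eq_inner_right, inner_zero_right]
          exact hx _ (hFS z)
        have h2 : S (τ i x) = 0 := by
          refine ext_inner_left ℂ fun z => ?_
          rw [← hSpos.inner_left_eq_inner_right, inner_zero_right,
            ← ContinuousLinearMap.adjoint_inner_left]
          exact hx _ (hFτ' i z)
        simp [h1, h2]
      · exact Submodule.sub_mem _ (hFτ i x) (hFS _)
      · simp [hA x (hGF x hx), hA _ (hGτ i x hx)]
      -- Moving `τ i` and `A` onto `z` only meets vectors of `G`, which `A` fixes, so the two terms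
      -- cancel.
      · intro z hz
        rw [sub_apply, inner_sub_right, mul_apply_eq_comp, mul_apply_eq_comp,
          ← ContinuousLinearMap.adjoint_inner_left, ← A.2.1.inner_left_eq_inner_right,
          ← A.2.1.inner_left_eq_inner_right, hA _ (hGτ' i z hz), hA z (hGF z hz),
          ContinuousLinearMap.adjoint_inner_left, sub_self]

/-- The bound for the symmetric norm of the commutators can be achieved with commutators that are
small in operator norm. -/
theorem IsSymmetricIdealNorm.exists_norm_commutator_le {ν : (H →L[ℂ] H) → ℝ≥0∞}
    (hν : IsSymmetricIdealNorm ν) {n : ℕ} (τ : Fin n → H →L[ℂ] H) {c : ℝ≥0∞}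
    (hc : ∀ B : FiniteRankPosContraction H, ∃ A ≥ B, ∀ i, ν (τ i * A.1 - A.1 * τ i) ≤ c)
    (A₀ : FiniteRankPosContraction H) {ε : ℝ} (hε : 0 < ε) :
    ∃ A ≥ A₀, ∀ i, ν (τ i * A.1 - A.1 * τ i) ≤ c ∧ ‖τ i * A.1 - A.1 * τ i‖ ≤ ε := by
  let C : ℝ := ∑ i, 2 * ‖τ i‖
  have hC0 : 0 ≤ C := Finset.sum_nonneg fun i _ => by positivity
  have hC : ∀ i, 2 * ‖τ i‖ ≤ C := fun i =>
    Finset.single_le_sum (f := fun i => 2 * ‖τ i‖) (fun i _ => by positivity) (Finset.mem_univ i)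
  -- Dividing the sum of `N` competitors by `N` brings the bound `C` below `ε`; passing to `M + 1`
  -- keeps `N` nonzero.
  obtain ⟨M, hM⟩ := exists_nat_ge (C / ε)
  let N := M + 1
  have hN0 : (0 : ℝ) < N := by positivity
  have hNC : (N : ℂ) ≠ 0 := by exact_mod_cast hN0.ne'
  obtain ⟨S, hSpos, hSN, hSfin, hSA, hSν, hSC⟩ :=
    hν.exists_sum_norm_commutator_le τ hc A₀ hC0 hC N
  have hinv : ∀ {X : H →L[ℂ] H}, X.IsPositive → ((((N : ℝ)⁻¹ : ℝ) : ℂ) • X).IsPositive :=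
    fun hX => hX.smul_of_nonneg (by exact_mod_cast (inv_pos.2 hN0).le)
  have hnorm : ‖(((N : ℝ)⁻¹ : ℝ) : ℂ)‖ = (N : ℝ)⁻¹ := by
    rw [Complex.norm_real, Real.norm_of_nonneg (inv_pos.2 hN0).le]
  have hcomm : ∀ i, τ i * ((((N : ℝ)⁻¹ : ℝ) : ℂ) • S) - ((((N : ℝ)⁻¹ : ℝ) : ℂ) • S) * τ i =
      (((N : ℝ)⁻¹ : ℝ) : ℂ) • (τ i * S - S * τ i) := fun i => by
    rw [mul_smul_comm, smul_mul_assoc, smul_sub]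
  refine ⟨⟨(((N : ℝ)⁻¹ : ℝ) : ℂ) • S, hinv hSpos, ?_, hSfin.smul _⟩, ?_,
    fun i => ⟨?_, ?_⟩⟩
  · rw [norm_smul, hnorm, inv_mul_le_iff₀ hN0, mul_one]
    exact hSN
  · have := hinv hSA
    rw [smul_sub, smul_smul] at this
    have h1 : (((N : ℝ)⁻¹ : ℝ) : ℂ) * (N : ℂ) = 1 := by
      push_cast; exact inv_mul_cancel₀ hNC
    rw [h1, one_smul] at this
    exact this
  · simp only [hcomm]
    refine (hν.smul_le (hSfin.commutator _) (inv_pos.2 hN0).le).trans ?_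
    calc _ ≤ ENNReal.ofReal (N : ℝ)⁻¹ * (N * c) := by gcongr; exact hSν i
      _ = c := by
        rw [← mul_assoc, ENNReal.ofReal_inv_of_pos hN0, ENNReal.ofReal_natCast,
          ENNReal.inv_mul_cancel, one_mul]
        · exact_mod_cast hN0.ne'
        · exact ENNReal.natCast_ne_top N
  · simp only [hcomm]
    rw [norm_smul, hnorm, inv_mul_le_iff₀ hN0]
    refine (hSC i).trans ?_
    rw [div_le_iff₀ hε] at hM
    refine hM.trans ?_
    have : (M : ℝ) ≤ N := by simp [N]
    gcongr

end FiniteRankPosContraction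

/-! ### Quasicentral moduli of block diagonal tuples -/

section Average

variable {H : Type*} [NormedAddCommGroup H] [InnerProductSpace ℂ H] {m : ℕ}

namespace FiniteRankPosContraction

/-- The average of positive contractions of finite rank. -/
noncomputable def average (hm : 1 ≤ m) (A : Fin m → FiniteRankPosContraction H) :
    FiniteRankPosContraction H :=
  ⟨((m : ℝ)⁻¹ : ℝ) • ∑ j, (A j).1, by
    rw [← Complex.coe_smul]
    exact (ContinuousLinearMap.isPositive_sum _ fun j _ => (A j).2.1).smul_of_nonneg
      (by exact_mod_cast (by positivity : (0 : ℝ) ≤ (m : ℝ)⁻¹)), by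
    have hm0 : (0 : ℝ) < m := by exact_mod_cast hm
    rw [norm_smul, Real.norm_of_nonneg (by positivity), inv_mul_le_iff₀ hm0, mul_one]
    refine (norm_sum_le _ _).trans ((Finset.sum_le_sum fun j _ => (A j).2.2.1).trans ?_)
    simp, by
    rw [← Complex.coe_smul]
    exact (IsFiniteRank.sum _ fun j _ => (A j).isFiniteRank).smul _⟩

theorem le_average (hm : 1 ≤ m) {A : Fin m → FiniteRankPosContraction H}
    {B : FiniteRankPosContraction H} (hAB : ∀ j, B ≤ A j) : B ≤ average hm A := by
  have hm0 : (m : ℝ) ≠ 0 := by exact_mod_cast (by omega : m ≠ 0)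
  change (((m : ℝ)⁻¹ : ℝ) • ∑ j, (A j).1 - B.1).IsPositive
  have h1 : (∑ j, ((A j).1 - B.1)).IsPositive :=
    ContinuousLinearMap.isPositive_sum _ fun j _ => hAB j
  have h2 := h1.smul_of_nonneg (c := (((m : ℝ)⁻¹ : ℝ) : ℂ))
    (by exact_mod_cast (by positivity : (0 : ℝ) ≤ (m : ℝ)⁻¹))
  convert! h2 using 1
  rw [Complex.coe_smul, Finset.sum_sub_distrib, smul_sub, Finset.sum_const, Finset.card_univ,
    Fintype.card_fin, ← Nat.cast_smul_eq_nsmul ℝ, smul_smul, inv_mul_cancel₀ hm0, one_smul]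

end FiniteRankPosContraction

end Average

section BlockDiagonalModulus

variable {H K : Type*} [NormedAddCommGroup H] [InnerProductSpace ℂ H] [CompleteSpace H]
  [NormedAddCommGroup K] [InnerProductSpace ℂ K] [CompleteSpace K] {m : ℕ}

open ContinuousLinearMap (adjoint)

namespace FiniteRankPosContraction

variable {ι : Fin m → H →L[ℂ] K}

/-- The block diagonal operator whose blocks are positive contractions of finite rank. -/
noncomputable def blockDiag (h : IsSlicing ι) (A : Fin m → FiniteRankPosContraction H) :
    FiniteRankPosContraction K :=
  ⟨_root_.blockDiag ι fun j => (A j).1, isPositive_blockDiag ι fun j => (A j).2.1,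
    h.norm_blockDiag_le zero_le_one fun j => (A j).2.2.1,
    isFiniteRank_blockDiag ι fun j => (A j).isFiniteRank⟩

/-- The diagonal blocks of a positive contraction of finite rank. -/
noncomputable def diagBlock (h : IsSlicing ι) (A : FiniteRankPosContraction K) (j : Fin m) :
    FiniteRankPosContraction H :=
  ⟨_root_.diagBlock ι A.1 j, isPositive_diagBlock ι A.2.1 j,
    (h.norm_diagBlock_le A.1 j).trans A.2.2.1, isFiniteRank_diagBlock ι A.isFiniteRank j⟩

theorem blockDiag_mono (h : IsSlicing ι) {A B : Fin m → FiniteRankPosContraction H}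
    (hAB : ∀ j, A j ≤ B j) : blockDiag h A ≤ blockDiag h B := by
  change (_root_.blockDiag ι _ - _root_.blockDiag ι _).IsPositive
  rw [blockDiag_sub]
  exact isPositive_blockDiag ι fun j => hAB j

theorem le_diagBlock (h : IsSlicing ι) {A : Fin m → FiniteRankPosContraction H}
    {B : FiniteRankPosContraction K} (hAB : blockDiag h A ≤ B) (j : Fin m) :
    A j ≤ diagBlock h B j := by
  change (_root_.diagBlock ι B.1 j - (A j).1).IsPositive
  have h1 := isPositive_diagBlock ι (show (B.1 - (blockDiag h A).1).IsPositive from hAB) j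
  convert! h1 using 1
  ext x
  simp [_root_.diagBlock, blockDiag, h.blockDiag_slice, h.adjoint_apply]

/-- Project onto the span of all components of the range of `B`. Hence the operators P ⊕ ⋯ ⊕ P are
cofinal. -/
theorem exists_le_blockDiag (h : IsSlicing ι) (B : FiniteRankPosContraction K) :
    ∃ P : FiniteRankPosContraction H, B ≤ blockDiag h fun _ => P := by
  have hB : FiniteDimensional ℂ B.1.range := B.2.2.2
  let F : Submodule ℂ H := ⨆ j, B.1.range.map (adjoint (ι j) : K →ₗ[ℂ] H)
  refine ⟨proj F, B.2.1.le_of_mul_eq B.2.2.1 (blockDiag h fun _ => proj F).2.1 ?_ ?_⟩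
  · change _root_.blockDiag ι _ * _root_.blockDiag ι _ = _root_.blockDiag ι _
    rw [h.blockDiag_mul]
    congr 1
    ext j : 1
    exact F.isIdempotentElem_starProjection
  · ext x
    refine h.ext_vector fun j => ?_
    rw [mul_apply_eq_comp]
    refine (h.adjoint_blockDiag _ j _).trans ?_
    refine Submodule.starProjection_eq_self_iff.2 ?_
    exact (le_iSup (fun j => B.1.range.map (adjoint (ι j) : K →ₗ[ℂ] H)) j) ⟨B.1 x, ⟨x, rfl⟩, rfl⟩

end FiniteRankPosContraction

variable {ι : Fin m → H →L[ℂ] K} {n : ℕ}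

/-- The pinching of a competitor is a competitor, and its commutators are the pinched ones up to the
block coefficients. With the four parameters, one statement yields both the lower and the upper
bound. -/
theorem quasicentralModulus_blockDiag_le {ν : (K →L[ℂ] K) → ℝ≥0∞} (hν : IsSymmetricIdealNorm ν)
    (h : IsSlicing ι) (hm : 1 ≤ m) (τ : Fin n → H →L[ℂ] H) {a b : Fin m → ℝ} {c d : ℝ}
    (hc : 0 ≤ c) (hd : 0 ≤ d) (hab : ∀ j, |c * a j| ≤ |d * b j|) :
    ENNReal.ofReal c * quasicentralModulus ν (fun i => blockDiag ι fun j => (a j : ℂ) • τ i) ≤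
      ENNReal.ofReal d *
        quasicentralModulus ν (fun i => blockDiag ι fun j => (b j : ℂ) • τ i) := by
  refine mul_liminf_atTop_le ENNReal.ofReal_ne_top fun B => ?_
  obtain ⟨P, hP⟩ := FiniteRankPosContraction.exists_le_blockDiag h B
  refine ⟨_, fun A hA => ⟨FiniteRankPosContraction.blockDiag h
    (FiniteRankPosContraction.diagBlock h A), hP.trans (FiniteRankPosContraction.blockDiag_mono h
      (FiniteRankPosContraction.le_diagBlock h hA)), ?_⟩⟩
  rw [ENNReal.mul_iSup]
  refine iSup_le fun i => ?_
  let X : Fin m → H →L[ℂ] H := fun j => τ i * diagBlock ι A.1 j - diagBlock ι A.1 j * τ i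
  have hX : ∀ j, IsFiniteRank (X j) := fun j =>
    (isFiniteRank_diagBlock ι A.isFiniteRank j).commutator _
  have h1 : (blockDiag ι fun j => (a j : ℂ) • τ i) * blockDiag ι (diagBlock ι A.1) -
      blockDiag ι (diagBlock ι A.1) * (blockDiag ι fun j => (a j : ℂ) • τ i) =
      blockDiag ι fun j => (a j : ℂ) • X j := by
    rw [h.blockDiag_mul, h.blockDiag_mul, blockDiag_sub]
    congr 1
    ext j : 1
    simp only [X, smul_mul_assoc, mul_smul_comm, smul_sub]
  have h2 : diagBlock ι ((blockDiag ι fun j => (b j : ℂ) • τ i) * A.1 -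
      A.1 * (blockDiag ι fun j => (b j : ℂ) • τ i)) = fun j => (b j : ℂ) • X j := by
    ext j : 1
    rw [h.diagBlock_commutator]
    simp only [X, smul_mul_assoc, mul_smul_comm, smul_sub]
  have hsmul : ∀ (r : ℝ) (e : Fin m → ℝ), (r : ℂ) • (blockDiag ι fun j => (e j : ℂ) • X j) =
      blockDiag ι fun j => ((r * e j : ℝ) : ℂ) • X j := by
    intro r e
    ext x
    rw [smul_apply, blockDiag_apply, blockDiag_apply, Finset.smul_sum]
    refine Finset.sum_congr rfl fun j _ => ?_
    rw [smul_apply, smul_apply, map_smul, map_smul, smul_smul, Complex.ofReal_mul]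
  calc _ = ENNReal.ofReal c * ν (blockDiag ι fun j => (a j : ℂ) • X j) := by rw [← h1]; rfl
    _ ≤ ν ((c : ℂ) • (blockDiag ι fun j => (a j : ℂ) • X j)) :=
      hν.mul_le_smul (isFiniteRank_blockDiag ι fun j => (hX j).smul _) hc
    _ ≤ ν ((d : ℂ) • (blockDiag ι fun j => (b j : ℂ) • X j)) := by
      rw [hsmul, hsmul]
      exact hν.blockDiag_smul_le h hX hab
    _ ≤ ENNReal.ofReal d * ν (blockDiag ι fun j => (b j : ℂ) • X j) :=
      hν.smul_le (isFiniteRank_blockDiag ι fun j => (hX j).smul _) hd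
    _ ≤ _ := by
      refine mul_le_mul_right ?_ _
      rw [← h2]
      exact (hν.blockDiag_diagBlock_le h hm (A.isFiniteRank.commutator _)).trans
        (le_iSup (fun i => ν ((blockDiag ι fun j => (b j : ℂ) • τ i) * A.1 -
          A.1 * (blockDiag ι fun j => (b j : ℂ) • τ i))) i)

/-- The average of the diagonal blocks of a competitor on `K` is the competitor on `H`; pinching and
block averaging control its commutators. -/
theorem mul_quasicentralModulus_le_blockDiag {ν : (K →L[ℂ] K) → ℝ≥0∞}
    (hν : IsSymmetricIdealNorm ν) {νH : (H →L[ℂ] H) → ℝ≥0∞} (h : IsSlicing ι) (hm : 1 ≤ m)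
    {M : ℝ≥0∞} (hM : ∀ X, IsFiniteRank X → M * νH X ≤ ν (blockDiag ι fun _ => X))
    (τ : Fin n → H →L[ℂ] H) :
    M * quasicentralModulus νH τ ≤ quasicentralModulus ν (fun i => blockDiag ι fun _ => τ i) := by
  rw [← one_mul (quasicentralModulus ν _)]
  refine mul_liminf_atTop_le ENNReal.one_ne_top fun B => ?_
  refine ⟨FiniteRankPosContraction.blockDiag h fun _ => B, fun A hA =>
    ⟨FiniteRankPosContraction.average hm (FiniteRankPosContraction.diagBlock h A),
      FiniteRankPosContraction.le_average hm (FiniteRankPosContraction.le_diagBlock h hA), ?_⟩⟩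
  rw [ENNReal.mul_iSup, one_mul]
  refine iSup_le fun i => ?_
  let X : Fin m → H →L[ℂ] H := fun j => τ i * diagBlock ι A.1 j - diagBlock ι A.1 j * τ i
  have hX : ∀ j, IsFiniteRank (X j) := fun j =>
    (isFiniteRank_diagBlock ι A.isFiniteRank j).commutator _
  have h1 : τ i * (((m : ℝ)⁻¹ : ℝ) • ∑ j, diagBlock ι A.1 j) -
      (((m : ℝ)⁻¹ : ℝ) • ∑ j, diagBlock ι A.1 j) * τ i = ((m : ℝ)⁻¹ : ℝ) • ∑ j, X j := by
    rw [mul_smul_comm, smul_mul_assoc, Finset.mul_sum, Finset.sum_mul, ← smul_sub,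
      ← Finset.sum_sub_distrib]
  have h2 : diagBlock ι ((blockDiag ι fun _ => τ i) * A.1 - A.1 * (blockDiag ι fun _ => τ i)) =
      X := by
    ext j : 1
    exact h.diagBlock_commutator _ _ _
  have hfin : IsFiniteRank (((m : ℝ)⁻¹ : ℝ) • ∑ j, X j : H →L[ℂ] H) := by
    rw [← Complex.coe_smul]
    exact (IsFiniteRank.sum _ fun j _ => hX j).smul _
  calc _ = M * νH (((m : ℝ)⁻¹ : ℝ) • ∑ j, X j) := by rw [← h1]; rfl
    _ ≤ ν (blockDiag ι fun _ => ((m : ℝ)⁻¹ : ℝ) • ∑ j, X j) := hM _ hfin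
    _ ≤ ν (blockDiag ι X) := hν.blockDiag_average_le h hm hX
    _ ≤ _ := by
      rw [← h2]
      exact (hν.blockDiag_diagBlock_le h hm (A.isFiniteRank.commutator _)).trans
        (le_iSup (fun i => ν ((blockDiag ι fun _ => τ i) * A.1 -
          A.1 * (blockDiag ι fun _ => τ i))) i)

/-- The competitors are A ⊕ ⋯ ⊕ A, with `A` chosen so that its commutators are also small in
operator norm; this absorbs the error term `C * ‖X‖`. -/
theorem quasicentralModulus_blockDiag_le_mul {ν : (K →L[ℂ] K) → ℝ≥0∞}
    {νH : (H →L[ℂ] H) → ℝ≥0∞} (hνH : IsSymmetricIdealNorm νH) (h : IsSlicing ι)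
    {M : ℝ≥0∞} (hM0 : M ≠ 0) (hMt : M ≠ ∞) {C : ℝ} (hC : 0 ≤ C)
    (hM : ∀ X, IsFiniteRank X →
      ν (blockDiag ι fun _ => X) ≤ M * νH X + ENNReal.ofReal (C * ‖X‖))
    (τ : Fin n → H →L[ℂ] H) :
    quasicentralModulus ν (fun i => blockDiag ι fun _ => τ i) ≤ M * quasicentralModulus νH τ := by
  rcases eq_or_ne (quasicentralModulus νH τ) ∞ with hk | hk
  · rw [hk, ENNReal.mul_top hM0]
    exact le_top
  refine ENNReal.le_of_forall_pos_le_add fun δ hδ _ => ?_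
  refine Filter.liminf_le_of_frequently_le' (Filter.frequently_atTop.2 fun B => ?_)
  obtain ⟨P, hP⟩ := FiniteRankPosContraction.exists_le_blockDiag h B
  have hD : 0 < M.toReal + C + 1 := by positivity
  -- The total error is `(M.toReal + C) * ε ≤ δ`; the added `1` keeps the denominator positive.
  let ε : ℝ := δ / (M.toReal + C + 1)
  have hε : 0 < ε := div_pos (by exact_mod_cast hδ) hD
  obtain ⟨A, hAP, hA⟩ := hνH.exists_norm_commutator_le τ
    (c := quasicentralModulus νH τ + ENNReal.ofReal ε) (fun B => by
      have hlt : quasicentralModulus νH τ < quasicentralModulus νH τ + ENNReal.ofReal ε :=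
        ENNReal.lt_add_right hk (by simpa using hε)
      obtain ⟨A, hAB, hA⟩ := Filter.frequently_atTop.1 (Filter.frequently_lt_of_liminf_lt
        (by isBoundedDefault) hlt) B
      exact ⟨A, hAB, fun i =>
        (le_iSup (fun i => νH (τ i * A.1 - A.1 * τ i)) i).trans hA.le⟩) P hε
  refine ⟨FiniteRankPosContraction.blockDiag h fun _ => A,
    hP.trans (FiniteRankPosContraction.blockDiag_mono h fun _ => hAP), iSup_le fun i => ?_⟩
  have h1 : (blockDiag ι fun _ => τ i) * (FiniteRankPosContraction.blockDiag h fun _ => A).1 -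
      (FiniteRankPosContraction.blockDiag h fun _ => A).1 * (blockDiag ι fun _ => τ i) =
      blockDiag ι fun _ => τ i * A.1 - A.1 * τ i := by
    change (blockDiag ι fun _ => τ i) * (blockDiag ι fun _ => A.1) -
      (blockDiag ι fun _ => A.1) * (blockDiag ι fun _ => τ i) = _
    rw [h.blockDiag_mul, h.blockDiag_mul, blockDiag_sub]
  rw [h1]
  refine (hM _ (A.isFiniteRank.commutator _)).trans ?_
  calc _ ≤ M * (quasicentralModulus νH τ + ENNReal.ofReal ε) + ENNReal.ofReal (C * ε) := by
        gcongr
        exacts [(hA i).1, (hA i).2]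
    _ = M * quasicentralModulus νH τ + ENNReal.ofReal ((M.toReal + C) * ε) := by
        rw [mul_add, add_assoc, add_mul, ENNReal.ofReal_add (by positivity) (by positivity),
          ENNReal.ofReal_mul ENNReal.toReal_nonneg, ENNReal.ofReal_toReal hMt]
    _ ≤ M * quasicentralModulus νH τ + δ := by
        gcongr
        refine ENNReal.ofReal_le_of_le_toReal ?_
        rw [ENNReal.coe_toReal]
        have : (M.toReal + C + 1) * ε = δ := mul_div_cancel₀ _ hD.ne'
        linarith

/-! ### Lorentz norms of multiples of an operator -/

/-- Index by `l = m * i + j` with block number `j` as remainder: the copies of each `s i` are then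
consecutive and the order stays decreasing. -/
theorem IsSchmidt.blockDiag {T : H →L[ℂ] H} {r : ℕ} {s : Fin r → ℝ} {e f : Fin r → H}
    (hT : IsSchmidt T s e f) (h : IsSlicing ι) :
    IsSchmidt (blockDiag ι fun _ => T) (fun l : Fin (r * m) => s l.divNat)
      (fun l => ι l.modNat (e l.divNat)) (fun l => ι l.modNat (f l.divNat)) := by
  have horth : ∀ {g : Fin r → H}, Orthonormal ℂ g →
      Orthonormal ℂ (fun l : Fin (r * m) => ι l.modNat (g l.divNat)) := by
    intro g hg
    have : Orthonormal ℂ (fun q : Fin r × Fin m => ι q.2 (g q.1)) := by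
      rw [orthonormal_iff_ite]
      rintro ⟨i, j⟩ ⟨i', j'⟩
      rw [← ContinuousLinearMap.adjoint_inner_right, h.adjoint_apply]
      by_cases hj : j = j'
      · simp [hj, orthonormal_iff_ite.1 hg]
      · simp [hj]
    exact this.comp finProdFinEquiv.symm finProdFinEquiv.symm.injective
  refine ⟨fun _ => hT.pos _, fun i j hij => hT.anti ?_, horth hT.orthonormal_left,
    horth hT.orthonormal_right, fun x => ?_⟩
  · exact Nat.div_le_div_right hij
  · rw [blockDiag_apply]
    refine Eq.trans ?_ (Equiv.sum_comp finProdFinEquiv.symm fun q : Fin r × Fin m =>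
      (s q.1 : ℂ) • ⟪ι q.2 (e q.1), x⟫_ℂ • ι q.2 (f q.1)).symm
    rw [Fintype.sum_prod_type_right]
    refine Finset.sum_congr rfl fun j _ => ?_
    rw [hT.apply_eq, map_sum]
    refine Finset.sum_congr rfl fun i _ => ?_
    rw [map_smul, map_smul, ContinuousLinearMap.adjoint_inner_right]

theorem IsFiniteRank.singularValue_blockDiag {T : H →L[ℂ] H} (hT : IsFiniteRank T)
    (h : IsSlicing ι) (hm : 1 ≤ m) (j : ℕ) :
    singularValue (_root_.blockDiag ι fun _ => T) j = singularValue T (j / m) := by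
  obtain ⟨r, s, e, f, hS⟩ := hT.exists_isSchmidt
  rw [(hS.blockDiag h).singularValue_eq, hS.singularValue_eq]
  by_cases hj : j < r * m
  · rw [dif_pos hj, dif_pos ((Nat.div_lt_iff_lt_mul (by omega)).2 hj)]
    rfl
  · rw [dif_neg hj, dif_neg fun hj' => hj ((Nat.div_lt_iff_lt_mul (by omega)).1 hj')]

theorem IsFiniteRank.lorentzNorm_blockDiag {T : H →L[ℂ] H} (hT : IsFiniteRank T)
    (h : IsSlicing ι) (hm : 1 ≤ m) (p : ℝ≥0∞) :
    lorentzNorm p (_root_.blockDiag ι fun _ => T) = ∑' q : ℕ, ∑ t : Fin m,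
      ENNReal.ofReal (singularValue T q / ((m * q + t : ℝ) + 1) ^ (1 - p⁻¹.toReal)) := by
  have : NeZero m := ⟨by omega⟩
  rw [lorentzNorm_of_isFiniteRank p (isFiniteRank_blockDiag ι fun _ => hT),
    ← (Nat.divModEquiv m).symm.tsum_eq]
  refine (ENNReal.tsum_prod (f := fun (q : ℕ) (t : Fin m) =>
    ENNReal.ofReal (singularValue (_root_.blockDiag ι fun _ => T) ((Nat.divModEquiv m).symm (q, t)) /
      (((Nat.divModEquiv m).symm (q, t) : ℝ) + 1) ^ (1 - p⁻¹.toReal)))).trans ?_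
  refine tsum_congr fun q => ?_
  rw [tsum_fintype]
  refine Finset.sum_congr rfl fun t _ => ?_
  have h1 : (q * m + (t : ℕ)) / m = q := by
    rw [mul_comm, Nat.mul_add_div (by omega), Nat.div_eq_of_lt t.2, add_zero]
  simp only [Nat.divModEquiv_symm_apply, hT.singularValue_blockDiag h hm, h1]
  push_cast
  rw [mul_comm (q : ℝ)]

theorem natCast_div_rpow_one_sub {m : ℕ} (hm : 1 ≤ m) (β : ℝ) :
    (m : ℝ) / (m : ℝ) ^ (1 - β) = (m : ℝ) ^ β := by
  have hm0 : (0 : ℝ) < m := by exact_mod_cast hm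
  conv_lhs => rw [← Real.rpow_one (m : ℝ), Real.rpow_one (m : ℝ)]
  rw [div_eq_iff (by positivity), ← Real.rpow_add hm0]
  simp

theorem IsFiniteRank.mul_lorentzNorm_le_blockDiag {T : H →L[ℂ] H} (hT : IsFiniteRank T)
    (h : IsSlicing ι) (hm : 1 ≤ m) {p : ℝ≥0∞} (hp : 1 ≤ p) :
    ENNReal.ofReal ((m : ℝ) ^ p⁻¹.toReal) * lorentzNorm p T ≤
      lorentzNorm p (_root_.blockDiag ι fun _ => T) := by
  have hm0 : (0 : ℝ) < m := by exact_mod_cast hm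
  have hα := one_sub_toReal_inv_nonneg hp
  rw [hT.lorentzNorm_blockDiag h hm, lorentzNorm_of_isFiniteRank p hT, ← ENNReal.tsum_mul_left]
  refine ENNReal.tsum_le_tsum fun q => ?_
  have hμ := hT.singularValue_nonneg q
  rw [← ENNReal.ofReal_mul (by positivity), ← ENNReal.ofReal_sum_of_nonneg
    fun t _ => by positivity]
  refine ENNReal.ofReal_le_ofReal ?_
  -- In group `q` every denominator index satisfies m q + t + 1 ≤ m (q + 1), and m / m^(1 - 1/p) =
  -- m^(1/p).
  calc _ = ∑ _t : Fin m, singularValue T q / (m * (q + 1 : ℝ)) ^ (1 - p⁻¹.toReal) := by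
        rw [Finset.sum_const, Finset.card_univ, Fintype.card_fin, nsmul_eq_mul,
          Real.mul_rpow hm0.le (by positivity), ← natCast_div_rpow_one_sub hm]
        field_simp
    _ ≤ _ := by
        refine Finset.sum_le_sum fun t _ => ?_
        have ht : (t : ℝ) + 1 ≤ m := by exact_mod_cast t.2
        gcongr
        linarith

/-- Group `q + 1` is bounded by term `q` of the norm of `T`, since its singular value is no larger
and its indices are at least m (q + 1). The unmatched group `0` has `m` terms, each at most `‖T‖`.
-/
theorem IsFiniteRank.lorentzNorm_blockDiag_le {T : H →L[ℂ] H} (hT : IsFiniteRank T)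
    (h : IsSlicing ι) (hm : 1 ≤ m) {p : ℝ≥0∞} (hp : 1 ≤ p) :
    lorentzNorm p (_root_.blockDiag ι fun _ => T) ≤
      ENNReal.ofReal ((m : ℝ) ^ p⁻¹.toReal) * lorentzNorm p T + ENNReal.ofReal (m * ‖T‖) := by
  have hm0 : (0 : ℝ) < m := by exact_mod_cast hm
  have hα := one_sub_toReal_inv_nonneg hp
  rw [hT.lorentzNorm_blockDiag h hm, lorentzNorm_of_isFiniteRank p hT, ← ENNReal.tsum_mul_left,
    tsum_eq_zero_add' ENNReal.summable, add_comm]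
  refine add_le_add (ENNReal.tsum_le_tsum fun q => ?_) ?_
  · have hμ := hT.singularValue_nonneg q
    have hμ' := hT.singularValue_nonneg (q + 1)
    rw [← ENNReal.ofReal_mul (by positivity), ← ENNReal.ofReal_sum_of_nonneg
      fun t _ => by positivity]
    refine ENNReal.ofReal_le_ofReal ?_
    calc _ ≤ ∑ _t : Fin m, singularValue T q / (m * (q + 1 : ℝ)) ^ (1 - p⁻¹.toReal) := by
          refine Finset.sum_le_sum fun t _ => ?_
          have := hT.singularValue_antitone (Nat.le_succ q)
          simp only [Nat.succ_eq_add_one] at this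
          have ht : (0 : ℝ) ≤ t := by positivity
          push_cast
          gcongr
          linarith
      _ = _ := by
          rw [Finset.sum_const, Finset.card_univ, Fintype.card_fin, nsmul_eq_mul,
            Real.mul_rpow hm0.le (by positivity), ← natCast_div_rpow_one_sub hm]
          field_simp
          rw [sub_sub_cancel]
  · have hμ := hT.singularValue_nonneg 0
    rw [← ENNReal.ofReal_sum_of_nonneg fun t _ => by positivity]
    refine ENNReal.ofReal_le_ofReal ?_
    calc _ ≤ ∑ _t : Fin m, ‖T‖ := by
          refine Finset.sum_le_sum fun t _ => ?_
          refine (div_le_self hμ (Real.one_le_rpow ?_ hα)).trans hT.singularValue_zero_le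
          simp
      _ = _ := by simp

end BlockDiagonalModulus

/-! ### The slices of a tensor product -/

section TensorSlices

theorem EuclideanSpace.sum_smul_single {m : ℕ} (v : EuclideanSpace ℂ (Fin m)) :
    ∑ j, v j • EuclideanSpace.single j (1 : ℂ) = v := by
  ext k
  simp [Pi.single_apply]

variable {H : Type*} [NormedAddCommGroup H] [InnerProductSpace ℂ H] {m : ℕ}

open ContinuousLinearMap (adjoint)

variable (H) in
/-- The embedding `ξ ↦ ξ ⊗ e_j`. -/
noncomputable def tensorSlice (j : Fin m) : H →L[ℂ] H ⊗[ℂ] EuclideanSpace ℂ (Fin m) :=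
  ((TensorProduct.mk ℂ H (EuclideanSpace ℂ (Fin m))).flip
    (EuclideanSpace.single j 1)).mkContinuous 1 fun ξ => by simp [TensorProduct.norm_tmul]

theorem tensorSlice_apply (j : Fin m) (ξ : H) :
    tensorSlice H j ξ = ξ ⊗ₜ[ℂ] EuclideanSpace.single j (1 : ℂ) := rfl

variable [CompleteSpace H]

theorem adjoint_tensorSlice_tmul (j : Fin m) (ξ : H) (v : EuclideanSpace ℂ (Fin m)) :
    adjoint (tensorSlice H j) (ξ ⊗ₜ[ℂ] v) = v j • ξ := by
  refine ext_inner_left ℂ fun η => ?_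
  rw [ContinuousLinearMap.adjoint_inner_right, tensorSlice_apply, TensorProduct.inner_tmul,
    inner_smul_right, EuclideanSpace.inner_single_left]
  simp [mul_comm]

theorem isSlicing_tensorSlice : IsSlicing (tensorSlice H : Fin m → _) where
  adjoint_apply j k x := by
    rw [tensorSlice_apply, adjoint_tensorSlice_tmul]
    simp
  sum_apply x := by
    induction x with
    | zero => simp
    | add x y hx hy => simp only [map_add, Finset.sum_add_distrib, hx, hy]
    | tmul ξ v =>
      simp only [adjoint_tensorSlice_tmul, tensorSlice_apply, TensorProduct.smul_tmul]
      rw [← TensorProduct.tmul_sum, EuclideanSpace.sum_smul_single]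

theorem tensorTuple_diagonal {n : ℕ} (τ : Fin n → H →L[ℂ] H) (d : Fin m → ℂ) :
    tensorTuple τ (Matrix.diagonal d) =
      fun i => blockDiag (tensorSlice H) fun j => d j • τ i := by
  funext i
  ext x
  rw [blockDiag_apply]
  induction x with
  | zero => simp
  | add x y hx hy => simp only [map_add, Finset.sum_add_distrib, hx, hy]
  | tmul ξ v =>
    have hv : Matrix.toEuclideanCLM (𝕜 := ℂ) (Matrix.diagonal d) v =
        ∑ j, (d j * v j) • EuclideanSpace.single j (1 : ℂ) := by
      ext k
      simp [Pi.single_apply, Matrix.mulVec_diagonal]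
    change τ i ξ ⊗ₜ[ℂ] Matrix.toEuclideanCLM (𝕜 := ℂ) (Matrix.diagonal d) v = _
    rw [hv, TensorProduct.tmul_sum]
    refine Finset.sum_congr rfl fun j _ => ?_
    rw [adjoint_tensorSlice_tmul, tensorSlice_apply, smul_apply, map_smul, smul_smul,
      TensorProduct.smul_tmul]

end TensorSlices

end

theorem lemma3p6 {H : Type*} [NormedAddCommGroup H] [InnerProductSpace ℂ H] [CompleteSpace H]
    [TopologicalSpace.SeparableSpace H] {n m : ℕ} (hm : 1 ≤ m) (τ : Fin n → H →L[ℂ] H)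
    (a : Fin m → ℝ) (c₁ c₂ : ℝ) (hc₁ : 0 ≤ c₁) (ha : ∀ j, c₁ ≤ a j ∧ a j ≤ c₂) :
    (∀ Φ : SymmetricNormingFunction,
      ENNReal.ofReal c₁ * kPhi Φ (tensorTuple τ (1 : Matrix (Fin m) (Fin m) ℂ)) ≤
          kPhi Φ (tensorTuple τ (Matrix.diagonal fun j => (a j : ℂ))) ∧
        kPhi Φ (tensorTuple τ (Matrix.diagonal fun j => (a j : ℂ))) ≤
          ENNReal.ofReal c₂ * kPhi Φ (tensorTuple τ (1 : Matrix (Fin m) (Fin m) ℂ))) ∧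
    (∀ p : ℝ≥0∞, 1 < p →
      ENNReal.ofReal c₁ * (m : ℝ≥0∞) ^ p⁻¹.toReal * kMinus p τ ≤
          kMinus p (tensorTuple τ (Matrix.diagonal fun j => (a j : ℂ))) ∧
        kMinus p (tensorTuple τ (Matrix.diagonal fun j => (a j : ℂ))) ≤
          ENNReal.ofReal c₂ * (m : ℝ≥0∞) ^ p⁻¹.toReal * kMinus p τ) := by
  have hS : IsSlicing (tensorSlice H : Fin m → _) := isSlicing_tensorSlice
  have hc₂ : 0 ≤ c₂ := hc₁.trans ((ha ⟨0, hm⟩).1.trans (ha ⟨0, hm⟩).2)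
  have hone : tensorTuple τ (1 : Matrix (Fin m) (Fin m) ℂ) =
      fun i => blockDiag (tensorSlice H) fun _ => τ i := by
    rw [← Matrix.diagonal_one, tensorTuple_diagonal]
    simp
  have key : ∀ {ν : (H ⊗[ℂ] EuclideanSpace ℂ (Fin m) →L[ℂ] H ⊗[ℂ] EuclideanSpace ℂ (Fin m)) →
      ℝ≥0∞}, IsSymmetricIdealNorm ν →
      ENNReal.ofReal c₁ * quasicentralModulus ν (tensorTuple τ 1) ≤
          quasicentralModulus ν (tensorTuple τ (Matrix.diagonal fun j => (a j : ℂ))) ∧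
        quasicentralModulus ν (tensorTuple τ (Matrix.diagonal fun j => (a j : ℂ))) ≤
          ENNReal.ofReal c₂ * quasicentralModulus ν (tensorTuple τ 1) := by
    intro ν hν
    rw [hone, tensorTuple_diagonal]
    constructor
    · have := quasicentralModulus_blockDiag_le hν hS hm τ (a := fun _ => 1) (b := a) hc₁
        zero_le_one fun j => by
          rw [mul_one, one_mul]
          exact abs_le_abs_of_nonneg hc₁ (ha j).1
      simpa using this
    · have := quasicentralModulus_blockDiag_le hν hS hm τ (a := a) (b := fun _ => 1)
        zero_le_one hc₂ fun j => by
          rw [mul_one, one_mul]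
          exact abs_le_abs_of_nonneg (hc₁.trans (ha j).1) (ha j).2
      simpa using this
  refine ⟨fun Φ => key Φ.isSymmetricIdealNorm_opNorm, fun p hp => ?_⟩
  have hm0 : (0 : ℝ) < m := by exact_mod_cast hm
  have hM : (m : ℝ≥0∞) ^ p⁻¹.toReal = ENNReal.ofReal ((m : ℝ) ^ p⁻¹.toReal) := by
    rw [← ENNReal.ofReal_rpow_of_pos hm0, ENNReal.ofReal_natCast]
  -- The Lorentz scaling is exact at the level of the moduli, so the second claim reduces to the
  -- comparison `key`.
  have hk : kMinus p (tensorTuple τ (1 : Matrix (Fin m) (Fin m) ℂ)) =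
      (m : ℝ≥0∞) ^ p⁻¹.toReal * kMinus p τ := by
    rw [hM, hone]
    refine le_antisymm ?_ ?_
    · refine quasicentralModulus_blockDiag_le_mul (isSymmetricIdealNorm_lorentzNorm hp.le) hS
        ?_ ENNReal.ofReal_ne_top hm0.le
        (fun X hX => hX.lorentzNorm_blockDiag_le hS hm hp.le) τ
      simpa using Real.rpow_pos_of_pos hm0 _
    · exact mul_quasicentralModulus_le_blockDiag (isSymmetricIdealNorm_lorentzNorm hp.le) hS hm
        (fun X hX => hX.mul_lorentzNorm_le_blockDiag hS hm hp.le) τ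
  rw [mul_assoc, mul_assoc, ← hk]
  exact key (isSymmetricIdealNorm_lorentzNorm hp.le)
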